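/- Let $n\in\mathbb{N}$ and let $H_1,H_2\in C(\mathbb{R}^n\times\mathbb{R}^n)$, $H_i=H_i(\xi,p)$, be $\mathbb{Z}^n$-periodic in $\xi$ and coercive in $p$ uniformly in $\xi$, i.e. $\lim_{r\to\infty}\inf\{H_i(\xi,p):\xi\in\mathbb{R}^n,\ |p|\ge r\}=\infty$. Let $\Omega\subset\mathbb{R}^n$ be a bounded domain (nonempty, open, connected) with Lipschitz boundary, and let $g_1,g_2\in C(\partial\Omega)$. For $\varepsilon>0$ let $(u_1^\varepsilon,u_2^\varepsilon)\in C(\overline\Omega)^2$ be a viscosity solution of $$ (\mathrm{D}_\varepsilon)\qquad \begin{cases} u_1^\varepsilon+H_1\big(\tfrac{x}{\varepsilon},Du_1^\varepsilon\big)+\tfrac1\varepsilon(u_1^\varepsilon-u_2^\varepsilon)=0 & \text{in }\Omega,\\ u_2^\varepsilon+H_2\big(\tfrac{x}{\varepsilon},Du_2^\varepsilon\big)+\tfrac1\varepsilon(u_2^\varepsilon-u_1^\varepsilon)=0 & \text{in }\Omega,\\ u_i^\varepsilon=g_i & \text{on }\partial\Omega,\ i=1,2. \end{cases} $$ Here and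 below the boundary condition is understood in the sense of viscosity solutions: a function $u\in C(\overline\Omega)$ satisfies $u=g$ on $\partial\Omega$ for the equation $F(x,u,Du)=0$ if, for every $\varphi\in C^1(\mathbb{R}^n)$ and $x\in\partial\Omega$, one has $F(x,u(x),D\varphi(x))\le0$ or $u(x)\le g(x)$ whenever $u-\varphi$ has a local maximum relative to $\overline\Omega$ at $x$, and $F(x,u(x),D\varphi(x))\ge0$ or $u(x)\ge g(x)$ whenever $u-\varphi$ has a local minimum relative to $\overline\Omega$ at $x$. Then for every $P\in\mathbb{R}^n$ there is exactly one constant $\overline H(P)\in\mathbb{R}$ for which the cell problem $$ H_1(\xi,P+Dv_1)+v_1-v_2=\overline H(P),\qquad H_2(\xi,P+Dv_2)+v_2-v_1=\overline H(P)\qquad\text{in }\mathbb{R}^n $$ has a continuous $\mathbb{Z}^n$-periodic viscosity solution $(v_1,v_2)$. Moreover, there is a function $u\in C(\overline\Omega)$ such that both $u_1^\varepsilon$ and $u_2^\varepsilon$ converge to $u$ locally uniformly on $\Omega$ as $\varepsilon\to0^+$, and $u$ is a viscosity solution of $$ \begin{cases} u+\overline H(Du)=0 & \text{in }\Omega,\\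 u=\min\{g_1,g_2\} & \text{on }\partial\Omega, \end{cases} $$ again with the boundary condition in the sense of viscosity solutions. -/

import Mathlib

open Set Filter Topology

/-- `ℝⁿ` with its Euclidean norm. -/
abbrev Eucl (n : ℕ) : Type := EuclideanSpace ℝ (Fin n)

/-- `f` is `ℤⁿ`-periodic. -/
def IsZPeriodic {n : ℕ} {α : Type*} (f : Eucl n → α) : Prop :=
  ∀ (x : Eucl n) (z : Fin n → ℤ), f (x + WithLp.toLp 2 (fun i => (z i : ℝ))) = f x

/-- `H(ξ, p) → ∞` as `|p| → ∞`, uniformly in `ξ`. -/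
def IsCoerciveHamiltonian {n : ℕ} (H : Eucl n → Eucl n → ℝ) : Prop :=
  ∀ C : ℝ, ∃ r : ℝ, ∀ ξ p : Eucl n, r ≤ ‖p‖ → C ≤ H ξ p

/-- `Ω` has Lipschitz boundary: near each boundary point, `Ω` is the part of a ball lying strictly
above the graph of a Lipschitz function over the hyperplane orthogonal to some unit vector `ν`.
The vector `x - ⟪ν, x⟫ ν` is the orthogonal projection of `x` to that hyperplane. -/
def HasLipschitzBoundary {n : ℕ} (Ω : Set (Eucl n)) : Prop :=
  ∀ z ∈ frontier Ω, ∃ (ν : Eucl n) (r : ℝ) (K : NNReal) (γ : Eucl n → ℝ),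
    ‖ν‖ = 1 ∧ 0 < r ∧ LipschitzWith K γ ∧
      Ω ∩ Metric.ball z r =
        {x ∈ Metric.ball z r | γ (x - inner ℝ ν x • ν) < inner ℝ ν x}

section Viscosity

variable {n : ℕ}

/-- `u` is a viscosity subsolution of `F(x, u, Du) = 0` in the open set `U`. -/
def IsViscositySubsolution (U : Set (Eucl n)) (F : Eucl n → ℝ → Eucl n → ℝ)
    (u : Eucl n → ℝ) : Prop :=
  ∀ x ∈ U, ∀ φ : Eucl n → ℝ, ContDiff ℝ 1 φ →
    IsLocalMax (fun y => u y - φ y) x → F x (u x) (gradient φ x) ≤ 0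

/-- `u` is a viscosity supersolution of `F(x, u, Du) = 0` in the open set `U`. -/
def IsViscositySupersolution (U : Set (Eucl n)) (F : Eucl n → ℝ → Eucl n → ℝ)
    (u : Eucl n → ℝ) : Prop :=
  ∀ x ∈ U, ∀ φ : Eucl n → ℝ, ContDiff ℝ 1 φ →
    IsLocalMin (fun y => u y - φ y) x → 0 ≤ F x (u x) (gradient φ x)

/-- `u` is a viscosity solution of `F(x, u, Du) = 0` in the open set `U`. -/
def IsViscositySolution (U : Set (Eucl n)) (F : Eucl n → ℝ → Eucl n → ℝ)
    (u : Eucl n → ℝ) : Prop :=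
  IsViscositySubsolution U F u ∧ IsViscositySupersolution U F u

/-- `u ∈ C(closure Ω)` is a solution of the Dirichlet problem `F(x, u, Du) = 0` in `Ω`, `u = g` on
`∂Ω`, where the boundary condition is understood in the sense of viscosity solutions:
`min {F(x, u, Du), u - g} ≤ 0` and `max {F(x, u, Du), u - g} ≥ 0` on `∂Ω`, tested at local maxima
and minima relative to the closure of `Ω`. -/
structure IsDirichletViscositySolution (Ω : Set (Eucl n)) (F : Eucl n → ℝ → Eucl n → ℝ)
    (g : Eucl n → ℝ) (u : Eucl n → ℝ) : Prop where
  continuousOn : ContinuousOn u (closure Ω)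
  interior : IsViscositySolution Ω F u
  boundary_sub : ∀ x ∈ frontier Ω, ∀ φ : Eucl n → ℝ, ContDiff ℝ 1 φ →
    IsLocalMaxOn (fun y => u y - φ y) (closure Ω) x →
      F x (u x) (gradient φ x) ≤ 0 ∨ u x ≤ g x
  boundary_super : ∀ x ∈ frontier Ω, ∀ φ : Eucl n → ℝ, ContDiff ℝ 1 φ →
    IsLocalMinOn (fun y => u y - φ y) (closure Ω) x →
      0 ≤ F x (u x) (gradient φ x) ∨ g x ≤ u x

/-- The pair `(u₁, u₂)` solves the weakly coupled Dirichlet problem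
`uᵢ + Hᵢ(x/ε, Duᵢ) + (uᵢ - uⱼ)/ε = 0` in `Ω`, `uᵢ = gᵢ` on `∂Ω` (`{i, j} = {1, 2}`). -/
def IsDirichletSystemSolution (Ω : Set (Eucl n)) (H₁ H₂ : Eucl n → Eucl n → ℝ)
    (g₁ g₂ : Eucl n → ℝ) (ε : ℝ) (u₁ u₂ : Eucl n → ℝ) : Prop :=
  IsDirichletViscositySolution Ω
      (fun x r p => r + H₁ (ε⁻¹ • x) p + ε⁻¹ * (r - u₂ x)) g₁ u₁ ∧
    IsDirichletViscositySolution Ω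
      (fun x r p => r + H₂ (ε⁻¹ • x) p + ε⁻¹ * (r - u₁ x)) g₂ u₂

/-- The cell problem `Hᵢ(ξ, P + Dvᵢ) + vᵢ - vⱼ = c` in `ℝⁿ` (`{i, j} = {1, 2}`) has a continuous
periodic viscosity solution `(v₁, v₂)`. -/
def IsCellConstant (H₁ H₂ : Eucl n → Eucl n → ℝ) (P : Eucl n) (c : ℝ) : Prop :=
  ∃ v₁ v₂ : Eucl n → ℝ, Continuous v₁ ∧ Continuous v₂ ∧ IsZPeriodic v₁ ∧ IsZPeriodic v₂ ∧
    IsViscositySolution univ (fun ξ r p => H₁ ξ (P + p) + r - v₂ ξ - c) v₁ ∧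
    IsViscositySolution univ (fun ξ r p => H₂ ξ (P + p) + r - v₁ ξ - c) v₂

/-- `Hbar` is the effective Hamiltonian of `(H₁, H₂)`: for every `P`, the cell problem is solvable
for the constant `Hbar P`, and for no other constant. -/
def IsEffectiveHamiltonian (H₁ H₂ : Eucl n → Eucl n → ℝ) (Hbar : Eucl n → ℝ) : Prop :=
  ∀ (P : Eucl n) (c : ℝ), IsCellConstant H₁ H₂ P c ↔ c = Hbar P

end Viscosity

/-! ### Gradients of the elementary test functions. -/

section TestFunctions

variable {n : ℕ} {f g : Eucl n → ℝ}

/-! The argument is compactness plus the perturbed test function method, with comparison for the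
limit problem to identify the limit.

The effective Hamiltonian comes from the discounted system `lam vᵢ + Gᵢ + vᵢ - vⱼ = 0`. Coercivity
bounds the gradients of its subsolutions independently of `lam`, so the supremum of subsolutions is
Lipschitz, and Perron's method needs no semicontinuous envelopes. As `lam → 0`, the normalized
solutions converge to a solution of the cell problem (`exists_cell_solution`). The constant is
unique because, at a joint maximum of `vᵢ - wᵢ` over points and components, the coupling terms have
a favourable sign (`cell_compare`). The same comparison makes `Hbar` continuous.

For the Dirichlet problems, `exists_uniform_bound` gives three estimates uniform in `ε`: the
solutions are bounded, their components differ by `O(ε)`, and their superdifferentials are bounded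
wherever the equation holds. On a Lipschitz domain this yields equicontinuity, so a common limit `w`
of both components exists along suitable `ε`. The gradient bound also excludes `uᵢ > gᵢ` on the
boundary, since such a function could be touched from above by arbitrarily steep paraboloids centred
outside the closure (`le_of_superJet_bound_or`). Hence `w ≤ min g₁ g₂` there pointwise. Perturbing
test functions by `ε vᵢ(x/ε)` shows that `w` solves the limit equation (`limit_sub`, `limit_super`);
where `w < min g₁ g₂` on the boundary, both components lie below their data, so the supersolution
property holds up to the boundary. By `limit_comparison` all cluster limits agree, and the whole
family converges.

The Hamiltonians are merely continuous, so doubling of variables cannot rely on a structure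
condition in `x`. Instead, one of the two functions has bounded superdifferentials; the doubled
gradients then have a limit `p`, and both inequalities hold at the same point `x₀` because they are
closed conditions on `(x, p)` (`exists_mem_closure_superJet_subJet`). -/

theorem gradient_fun_add (hf : ContDiff ℝ 1 f) (hg : ContDiff ℝ 1 g) (x : Eucl n) :
    gradient (fun y => f y + g y) x = gradient f x + gradient g x := by
  have h1 := (hf.differentiable one_ne_zero) x
  have h2 := (hg.differentiable one_ne_zero) x
  simp only [gradient]
  rw [fderiv_fun_add h1 h2, map_add]

theorem gradient_fun_neg (f : Eucl n → ℝ) (x : Eucl n) :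
    gradient (fun y => -f y) x = -gradient f x := by
  simp only [gradient]
  rw [fderiv_fun_neg, map_neg]

theorem gradient_fun_sub (hf : ContDiff ℝ 1 f) (hg : ContDiff ℝ 1 g) (x : Eucl n) :
    gradient (fun y => f y - g y) x = gradient f x - gradient g x := by
  simp only [sub_eq_add_neg]
  rw [gradient_fun_add hf hg.neg, gradient_fun_neg]

theorem contDiff_const_mul_norm_sub_sq (c : ℝ) (a : Eucl n) :
    ContDiff ℝ 1 (fun y : Eucl n => c * ‖y - a‖ ^ 2) :=
  contDiff_const.mul ((contDiff_id.sub contDiff_const).norm_sq ℝ)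

theorem gradient_const_mul_norm_sub_sq (c : ℝ) (a x : Eucl n) :
    gradient (fun y : Eucl n => c * ‖y - a‖ ^ 2) x = (2 * c) • (x - a) := by
  apply HasGradientAt.gradient
  rw [hasGradientAt_iff_hasFDerivAt]
  have h := (((hasFDerivAt_id x).sub_const a).norm_sq).const_mul c
  refine h.congr_fderiv ?_
  ext v
  simp
  ring

theorem continuous_gradient (hf : ContDiff ℝ 1 f) : Continuous (gradient f) :=
  (InnerProductSpace.toDual ℝ (Eucl n)).symm.continuous.comp (hf.continuous_fderiv one_ne_zero)

theorem gradient_comp_add_right (f : Eucl n → ℝ) (a x : Eucl n) :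
    gradient (fun y => f (y + a)) x = gradient f (x + a) := by
  simp only [gradient]
  rw [fderiv_comp_add_right]

theorem gradient_rescale (hf : ContDiff ℝ 1 f) {ε : ℝ} (hε : ε ≠ 0) (x : Eucl n) :
    gradient (fun y => ε⁻¹ * f (ε • y)) x = gradient f (ε • x) := by
  apply HasGradientAt.gradient
  rw [hasGradientAt_iff_hasFDerivAt]
  have h1 := ((hf.differentiable one_ne_zero) (ε • x)).hasGradientAt.hasFDerivAt
  have h2 := (h1.comp x ((hasFDerivAt_id x).const_smul ε)).const_mul ε⁻¹
  refine h2.congr_fderiv ?_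
  ext v
  simp [hε]

end TestFunctions

/-! ### First-order sub- and superdifferentials relative to a set. -/

section Jets

variable {n : ℕ}

/-- The graph of the superdifferential of `f` relative to `K`: all pairs `(x, ∇φ(x))` where
`x ∈ K` and `f - φ` has a local maximum relative to `K` at `x`. -/
def superJet (K : Set (Eucl n)) (f : Eucl n → ℝ) : Set (Eucl n × Eucl n) :=
  {q | q.1 ∈ K ∧ ∃ φ : Eucl n → ℝ, ContDiff ℝ 1 φ ∧
    IsLocalMaxOn (fun y => f y - φ y) K q.1 ∧ gradient φ q.1 = q.2}

/-- The graph of the subdifferential of `f` relative to `K`. -/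
def subJet (K : Set (Eucl n)) (f : Eucl n → ℝ) : Set (Eucl n × Eucl n) :=
  {q | q.1 ∈ K ∧ ∃ φ : Eucl n → ℝ, ContDiff ℝ 1 φ ∧
    IsLocalMinOn (fun y => f y - φ y) K q.1 ∧ gradient φ q.1 = q.2}

variable {K U : Set (Eucl n)} {f g φ : Eucl n → ℝ} {x p : Eucl n}

theorem mem_superJet_iff : (x, p) ∈ superJet K f ↔ x ∈ K ∧ ∃ φ : Eucl n → ℝ, ContDiff ℝ 1 φ ∧
    (∃ r > 0, ∀ y ∈ K, dist y x < r → f y - φ y ≤ f x - φ x) ∧ gradient φ x = p := by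
  have key : ∀ φ : Eucl n → ℝ, IsLocalMaxOn (fun y => f y - φ y) K x ↔
      ∃ r > 0, ∀ y ∈ K, dist y x < r → f y - φ y ≤ f x - φ x := by
    intro φ
    simp only [IsLocalMaxOn, IsMaxFilter, eventually_nhdsWithin_iff, Metric.eventually_nhds_iff]
    exact ⟨fun ⟨r, hr, h⟩ => ⟨r, hr, fun y hy hd => h hd hy⟩,
      fun ⟨r, hr, h⟩ => ⟨r, hr, fun y hd hy => h y hy hd⟩⟩
  simp only [superJet, mem_ofPred_eq, key]

theorem mem_subJet_iff : (x, p) ∈ subJet K f ↔ x ∈ K ∧ ∃ φ : Eucl n → ℝ, ContDiff ℝ 1 φ ∧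
    (∃ r > 0, ∀ y ∈ K, dist y x < r → f x - φ x ≤ f y - φ y) ∧ gradient φ x = p := by
  have key : ∀ φ : Eucl n → ℝ, IsLocalMinOn (fun y => f y - φ y) K x ↔
      ∃ r > 0, ∀ y ∈ K, dist y x < r → f x - φ x ≤ f y - φ y := by
    intro φ
    simp only [IsLocalMinOn, IsMinFilter, eventually_nhdsWithin_iff, Metric.eventually_nhds_iff]
    exact ⟨fun ⟨r, hr, h⟩ => ⟨r, hr, fun y hy hd => h hd hy⟩,
      fun ⟨r, hr, h⟩ => ⟨r, hr, fun y hd hy => h y hy hd⟩⟩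
  simp only [subJet, mem_ofPred_eq, key]

theorem mem_subJet_iff_neg : (x, p) ∈ subJet K f ↔ (x, -p) ∈ superJet K (fun y => -f y) := by
  rw [mem_subJet_iff, mem_superJet_iff]
  refine and_congr_right fun _ => ⟨?_, ?_⟩
  · rintro ⟨φ, hφ, ⟨r, hr, h⟩, hg⟩
    refine ⟨fun y => -φ y, hφ.neg, ⟨r, hr, fun y hy hd => ?_⟩, by rw [gradient_fun_neg, hg]⟩
    linarith [h y hy hd]
  · rintro ⟨φ, hφ, ⟨r, hr, h⟩, hg⟩
    refine ⟨fun y => -φ y, hφ.neg, ⟨r, hr, fun y hy hd => ?_⟩, by rw [gradient_fun_neg, hg, neg_neg]⟩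
    linarith [h y hy hd]

theorem superJet_mono {K' : Set (Eucl n)} (hKK : K' ⊆ K) (hx : x ∈ K') (h : (x, p) ∈ superJet K f) :
    (x, p) ∈ superJet K' f := by
  obtain ⟨-, φ, hφ, hmax, hg⟩ := h
  exact ⟨hx, φ, hφ, hmax.on_subset hKK, hg⟩

/-- A test function touching `g` from above at `x` also touches any smaller function that meets `g`
there. -/
theorem superJet_congr_at {g : Eucl n → ℝ} (hfg : ∀ y ∈ K, f y ≤ g y) (hx : f x = g x)
    (h : (x, p) ∈ superJet K g) : (x, p) ∈ superJet K f := by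
  rw [mem_superJet_iff] at h ⊢
  obtain ⟨hK, φ, hφ, ⟨r, hr, h⟩, hg⟩ := h
  refine ⟨hK, φ, hφ, ⟨r, hr, fun y hy hd => ?_⟩, hg⟩
  linarith [h y hy hd, hfg y hy]

/-- Stability of superdifferentials under one-sided perturbations. -/
theorem exists_superJet_near (hK : IsClosed K) (h : (x, p) ∈ superJet K f) {η : ℝ} (hη : 0 < η) :
    ∃ r > 0, r ≤ η ∧ ∃ ρ > 0, ρ ≤ η ∧ ∀ f' : Eucl n → ℝ,
      ContinuousOn f' (K ∩ Metric.closedBall x r) →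
      (∀ y ∈ K ∩ Metric.closedBall x r, f' y ≤ f y + ρ) → f x - ρ ≤ f' x →
      ∃ y q, (y, q) ∈ superJet K f' ∧ dist y x < r ∧ ‖q - p‖ < η ∧ f x - η < f' y := by
  rw [mem_superJet_iff] at h
  obtain ⟨hx, φ, hφ, ⟨r₀, hr₀, hmax⟩, rfl⟩ := h
  have c1 : ∀ᶠ y in 𝓝 x, dist (φ y) (φ x) < η / 4 :=
    Metric.tendsto_nhds.1 hφ.continuous.continuousAt _ (by positivity)
  have c2 : ∀ᶠ y in 𝓝 x, dist (gradient φ y) (gradient φ x) < η / 2 :=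
    Metric.tendsto_nhds.1 (continuous_gradient hφ).continuousAt _ (by positivity)
  obtain ⟨r₁, hr₁, hc⟩ := Metric.eventually_nhds_iff.1 (c1.and c2)
  set r := min (min (r₀ / 2) (r₁ / 2)) (η / 8) with hr
  have hrpos : 0 < r := by positivity
  have hr0 : r ≤ r₀ / 2 := (min_le_left _ _).trans (min_le_left _ _)
  have hr1 : r ≤ r₁ / 2 := (min_le_left _ _).trans (min_le_right _ _)
  have hr2 : r ≤ η / 8 := min_le_right _ _
  -- Adding `‖y - x‖²` to the test function makes the maximum strict. The perturbation costs at most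
  -- `2ρ ≤ r²/2`, less than the penalty `r²` on the sphere, so the new maximizer is interior.
  set ρ := min (r ^ 2 / 4) (η / 4) with hρ
  have hρpos : 0 < ρ := by positivity
  have hρ1 : ρ ≤ r ^ 2 / 4 := min_le_left _ _
  have hρ2 : ρ ≤ η / 4 := min_le_right _ _
  refine ⟨r, hrpos, by linarith, ρ, hρpos, by linarith, fun f' hcont hle hge => ?_⟩
  have hcpt : IsCompact (K ∩ Metric.closedBall x r) :=
    (isCompact_closedBall x r).inter_left hK
  have hxm : x ∈ K ∩ Metric.closedBall x r := ⟨hx, Metric.mem_closedBall_self hrpos.le⟩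
  have hψ : ContDiff ℝ 1 (fun y => φ y + 1 * ‖y - x‖ ^ 2) :=
    hφ.add (contDiff_const_mul_norm_sub_sq 1 x)
  obtain ⟨y, hy, hymax⟩ := hcpt.exists_isMaxOn ⟨x, hxm⟩
    (hcont.sub (hψ.continuous.continuousOn))
  have hdy : dist y x ≤ r := hy.2
  have h1 := hymax hxm
  simp only [mem_ofPred_eq, sub_self, norm_zero, Pi.sub_apply] at h1
  have h2 := hmax y hy.1 (by linarith)
  have h3 := hle y hy
  rw [← dist_eq_norm] at h1
  have hyr : dist y x < r := by
    refine lt_of_le_of_ne hdy fun he => ?_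
    rw [he] at h1
    nlinarith
  have hcy := hc (show dist y x < r₁ by linarith)
  refine ⟨y, _, mem_superJet_iff.2 ⟨hy.1, _, hψ, ⟨r - dist y x, by linarith, fun z hz hd => ?_⟩, rfl⟩,
    hyr, ?_, ?_⟩
  · exact hymax ⟨hz, by
      rw [Metric.mem_closedBall]; linarith [dist_triangle z y x]⟩
  · rw [gradient_fun_add hφ (contDiff_const_mul_norm_sub_sq 1 x), gradient_const_mul_norm_sub_sq]
    have : ‖(2 * 1 : ℝ) • (y - x)‖ ≤ η / 4 := by
      rw [norm_smul, ← dist_eq_norm]; norm_num; linarith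
    have h5 := hcy.2
    rw [dist_eq_norm] at h5
    calc _ = ‖(gradient φ y - gradient φ x) + (2 * 1 : ℝ) • (y - x)‖ := by congr 1; abel
      _ ≤ _ := norm_add_le _ _
      _ < η / 2 + η / 4 := add_lt_add_of_lt_of_le h5 this
      _ ≤ η := by linarith
  · have h5 := hcy.1
    rw [Real.dist_eq, abs_lt] at h5
    nlinarith [sq_nonneg (dist y x)]

/-- Points with nonempty superdifferential are dense. -/
theorem exists_superJet_of_continuousOn {r : ℝ} (hr : 0 < r) (hf : ContinuousOn f (Metric.closedBall x r)) :
    ∃ y q, (y, q) ∈ superJet univ f ∧ dist y x < r := by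
  obtain ⟨M, hM⟩ := (isCompact_closedBall x r).exists_bound_of_continuousOn hf
  have hM0 : 0 ≤ M := (norm_nonneg _).trans (hM x (Metric.mem_closedBall_self hr.le))
  -- The penalty on the sphere is then `2M + 1`, more than the oscillation `2M` of `f`.
  set B := (2 * M + 1) / r ^ 2
  have hBr : B * r ^ 2 = 2 * M + 1 := by simp only [B]; field_simp
  obtain ⟨y, hy, hymax⟩ := (isCompact_closedBall x r).exists_isMaxOn
    ⟨x, Metric.mem_closedBall_self hr.le⟩
    (hf.sub (contDiff_const_mul_norm_sub_sq B x).continuous.continuousOn)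
  have h1 := hymax (Metric.mem_closedBall_self hr.le)
  simp only [mem_ofPred_eq, sub_self, norm_zero, Pi.sub_apply] at h1
  rw [← dist_eq_norm] at h1
  have h2 := abs_le.1 (hM x (Metric.mem_closedBall_self hr.le))
  have h3 := abs_le.1 (hM y hy)
  have hyr : dist y x < r := by
    refine lt_of_le_of_ne hy fun he => ?_
    rw [he] at h1
    linarith
  refine ⟨y, _, mem_superJet_iff.2 ⟨mem_univ _, _, contDiff_const_mul_norm_sub_sq B x,
    ⟨r - dist y x, by linarith, fun z _ hd => ?_⟩, rfl⟩, hyr⟩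
  exact hymax (show dist z x ≤ r by linarith [dist_triangle z y x])

end Jets

/-! ### Doubling of variables and Lipschitz bounds from superdifferentials. -/

section Doubling

variable {n : ℕ} {K U : Set (Eucl n)} {f g φ : Eucl n → ℝ} {x x₀ p : Eucl n}

/-- Doubling of variables at a local maximum of `f - g - φ`. -/
theorem exists_superJet_subJet_near (hK : IsClosed K) (hx₀ : x₀ ∈ K) {r : ℝ} (hr : 0 < r)
    (hf : ContinuousOn f (Metric.closedBall x₀ r))
    (hg : ContinuousOn g (K ∩ Metric.closedBall x₀ r)) (hφ : ContDiff ℝ 1 φ)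
    (hmax : ∀ y ∈ K ∩ Metric.closedBall x₀ r, f y - g y - φ y ≤ f x₀ - g x₀ - φ x₀)
    {η : ℝ} (hη : 0 < η) :
    ∃ x p y q, (x, p) ∈ superJet univ f ∧ (y, q) ∈ subJet K g ∧ dist x x₀ < η ∧ dist y x₀ < η ∧
      ‖p - q - gradient φ x₀‖ < η := by
  set B := Metric.closedBall x₀ r with hB
  have hBc : IsCompact B := isCompact_closedBall x₀ r
  have hKB : IsCompact (K ∩ B) := hBc.inter_left hK
  have hxB : x₀ ∈ B := Metric.mem_closedBall_self hr.le
  have c2 : ∀ᶠ y in 𝓝 x₀, dist (gradient φ y) (gradient φ x₀) < η / 2 :=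
    Metric.tendsto_nhds.1 (continuous_gradient hφ).continuousAt _ (by positivity)
  obtain ⟨r₁, hr₁, hc⟩ := Metric.eventually_nhds_iff.1 c2
  set s := min (min (r / 2) (r₁ / 2)) (η / 8) with hs
  have hspos : 0 < s := by positivity
  have hs0 : s ≤ r / 2 := (min_le_left _ _).trans (min_le_left _ _)
  have hs1 : s ≤ r₁ / 2 := (min_le_left _ _).trans (min_le_right _ _)
  have hs2 : s ≤ η / 8 := min_le_right _ _
  obtain ⟨δ, hδ, hunif⟩ := Metric.uniformContinuousOn_iff.1
    (hBc.uniformContinuousOn_of_continuous hf) ((s / 2) ^ 2) (by positivity)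
  obtain ⟨M, hM⟩ := hBc.exists_bound_of_continuousOn hf
  have hM0 : 0 ≤ M := (norm_nonneg _).trans (hM x₀ hxB)
  set d := min δ (s / 2) with hd
  have hdpos : 0 < d := by positivity
  -- With this weight, separating the two points by `d` would cost more than the oscillation of `f`.
  set N := (2 * M + 1) / d ^ 2
  have hNd : N * d ^ 2 = 2 * M + 1 := by simp only [N]; field_simp
  have hN : 0 < N := by positivity
  have hcont : ContinuousOn (fun z : Eucl n × Eucl n =>
      f z.1 - g z.2 - φ z.2 - N * ‖z.1 - z.2‖ ^ 2 - 1 * ‖z.2 - x₀‖ ^ 2) (B ×ˢ (K ∩ B)) := by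
    have h1 : ContinuousOn (fun z : Eucl n × Eucl n => f z.1) (B ×ˢ (K ∩ B)) :=
      hf.comp continuousOn_fst fun z hz => hz.1
    have h2 : ContinuousOn (fun z : Eucl n × Eucl n => g z.2) (B ×ˢ (K ∩ B)) :=
      hg.comp continuousOn_snd fun z hz => hz.2
    have h3 : Continuous (fun z : Eucl n × Eucl n => φ z.2) := hφ.continuous.comp continuous_snd
    exact (((h1.sub h2).sub h3.continuousOn).sub (by fun_prop)).sub (by fun_prop)
  obtain ⟨⟨x, y⟩, ⟨hx, hy⟩, hxy⟩ := (hBc.prod hKB).exists_isMaxOn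
    ⟨(x₀, x₀), hxB, hx₀, hxB⟩ hcont
  have hxy' : ∀ x' ∈ B, ∀ y' ∈ K ∩ B,
      f x' - g y' - φ y' - N * ‖x' - y'‖ ^ 2 - 1 * ‖y' - x₀‖ ^ 2 ≤
      f x - g y - φ y - N * ‖x - y‖ ^ 2 - 1 * ‖y - x₀‖ ^ 2 := fun x' hx' y' hy' =>
    hxy (show (x', y') ∈ B ×ˢ (K ∩ B) from ⟨hx', hy'⟩)
  have h0 := hxy' x₀ hxB x₀ ⟨hx₀, hxB⟩
  have hm := hmax y hy
  simp only [sub_self, norm_zero] at h0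
  -- Since `g` and `φ` are both evaluated at `y`, they cancel against the maximality of `x₀` tested
  -- at `y`; only the modulus of continuity of `f` is needed.
  have key : N * ‖x - y‖ ^ 2 + ‖y - x₀‖ ^ 2 ≤ f x - f y := by nlinarith
  have hfx := abs_le.1 (hM x hx)
  have hfy := abs_le.1 (hM y hy.2)
  have hxyd : dist x y < d := by
    rw [dist_eq_norm]
    by_contra! hcon
    have : d ^ 2 ≤ ‖x - y‖ ^ 2 := by gcongr
    have : N * d ^ 2 ≤ N * ‖x - y‖ ^ 2 := by gcongr
    nlinarith [sq_nonneg ‖y - x₀‖]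
  have hff := hunif x hx y hy.2 (hxyd.trans_le (min_le_left _ _))
  rw [Real.dist_eq, abs_lt] at hff
  have hyd : dist y x₀ < s / 2 := by
    rw [dist_eq_norm]
    refine lt_of_pow_lt_pow_left₀ 2 (by positivity) ?_
    have : 0 ≤ N * ‖x - y‖ ^ 2 := by positivity
    linarith
  have hxd : dist x x₀ < s := by
    have := min_le_right δ (s / 2)
    linarith [dist_triangle x y x₀]
  refine ⟨x, _, y, _, mem_superJet_iff.2 ⟨mem_univ _, _, contDiff_const_mul_norm_sub_sq N y,
    ⟨r - dist x x₀, by linarith, fun z _ hz => ?_⟩, rfl⟩, mem_subJet_iff.2 ⟨hy.1,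
    fun z => -(φ z + N * ‖z - x‖ ^ 2 + 1 * ‖z - x₀‖ ^ 2),
    ((hφ.add (contDiff_const_mul_norm_sub_sq N x)).add (contDiff_const_mul_norm_sub_sq 1 x₀)).neg,
    ⟨r - dist y x₀, by linarith, fun z hz hzd => ?_⟩, rfl⟩, by linarith, by linarith, ?_⟩
  · have := hxy' z (show dist z x₀ ≤ r by linarith [dist_triangle z x x₀]) y hy
    linarith
  · have := hxy' x hx z ⟨hz, show dist z x₀ ≤ r by linarith [dist_triangle z y x₀]⟩
    beta_reduce
    rw [norm_sub_rev z x, norm_sub_rev y x]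
    linarith
  · rw [gradient_fun_neg, gradient_fun_add (hφ.add (contDiff_const_mul_norm_sub_sq N x))
      (contDiff_const_mul_norm_sub_sq 1 x₀), gradient_fun_add hφ
      (contDiff_const_mul_norm_sub_sq N x)]
    simp only [gradient_const_mul_norm_sub_sq]
    have h5 := hc (show dist y x₀ < r₁ by linarith)
    rw [dist_eq_norm] at h5
    have h6 : ‖(2 * 1 : ℝ) • (y - x₀)‖ ≤ η / 4 := by
      rw [norm_smul, ← dist_eq_norm]; norm_num; linarith
    calc _ = ‖(gradient φ y - gradient φ x₀) + (2 * 1 : ℝ) • (y - x₀)‖ := by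
          congr 1
          rw [← neg_sub x y, smul_neg]
          abel
      _ ≤ _ := norm_add_le _ _
      _ < η / 2 + η / 4 := add_lt_add_of_lt_of_le h5 h6
      _ ≤ η := by linarith

/-- Passage to the limit in pairs of jets with bounded first gradient. -/
theorem exists_mem_closure_of_near {A B : Set (Eucl n × Eucl n)} {c : Eucl n} {R : ℝ}
    (h : ∀ η > 0, ∃ x p y q, (x, p) ∈ A ∧ (y, q) ∈ B ∧ dist x x₀ < η ∧ dist y x₀ < η ∧
      ‖p - q - c‖ < η ∧ ‖p‖ ≤ R) :
    ∃ p, ‖p‖ ≤ R ∧ (x₀, p) ∈ closure A ∧ (x₀, p - c) ∈ closure B := by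
  choose x p y q hp hq hx hy hpq hR using fun k : ℕ => h (1 / ((k : ℝ) + 1)) (by positivity)
  have hlim : Tendsto (fun k : ℕ => 1 / ((k : ℝ) + 1)) atTop (𝓝 0) :=
    tendsto_one_div_add_atTop_nhds_zero_nat
  obtain ⟨p₀, hp₀, σ, hσ, hσlim⟩ := (isCompact_closedBall (0 : Eucl n) R).tendsto_subseq
    (fun k => mem_closedBall_zero_iff.2 (hR k))
  have hxl : Tendsto x atTop (𝓝 x₀) := tendsto_iff_dist_tendsto_zero.2
    (squeeze_zero (fun _ => dist_nonneg) (fun k => (hx k).le) hlim)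
  have hyl : Tendsto y atTop (𝓝 x₀) := tendsto_iff_dist_tendsto_zero.2
    (squeeze_zero (fun _ => dist_nonneg) (fun k => (hy k).le) hlim)
  have hpql : Tendsto (fun k => p k - q k - c) atTop (𝓝 0) :=
    tendsto_zero_iff_norm_tendsto_zero.2
      (squeeze_zero (fun _ => norm_nonneg _) (fun k => (hpq k).le) hlim)
  have hql : Tendsto (fun k => q (σ k)) atTop (𝓝 (p₀ - c)) := by
    have := hσlim.sub ((hpql.comp hσ.tendsto_atTop).add_const c)
    simpa using this
  exact ⟨p₀, mem_closedBall_zero_iff.1 hp₀,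
    mem_closure_of_tendsto ((hxl.comp hσ.tendsto_atTop).prodMk_nhds hσlim)
      (Eventually.of_forall fun k => hp (σ k)),
    mem_closure_of_tendsto ((hyl.comp hσ.tendsto_atTop).prodMk_nhds hql)
      (Eventually.of_forall fun k => hq (σ k))⟩

/-- Limiting form of the doubling of variables. -/
theorem exists_mem_closure_superJet_subJet (hK : IsClosed K) (hx₀ : x₀ ∈ K) {r : ℝ} (hr : 0 < r)
    (hf : ContinuousOn f (Metric.closedBall x₀ r))
    (hg : ContinuousOn g (K ∩ Metric.closedBall x₀ r)) (hφ : ContDiff ℝ 1 φ)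
    (hmax : ∀ y ∈ K ∩ Metric.closedBall x₀ r, f y - g y - φ y ≤ f x₀ - g x₀ - φ x₀)
    {R : ℝ} (hR : ∀ x p, (x, p) ∈ superJet univ f → dist x x₀ < r → ‖p‖ ≤ R) :
    ∃ p, ‖p‖ ≤ R ∧ (x₀, p) ∈ closure (superJet univ f) ∧
      (x₀, p - gradient φ x₀) ∈ closure (subJet K g) := by
  refine exists_mem_closure_of_near fun η hη => ?_
  obtain ⟨x, p, y, q, hp, hq, hx, hy, hpq⟩ :=
    exists_superJet_subJet_near hK hx₀ hr hf hg hφ hmax (lt_min hη hr)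
  exact ⟨x, p, y, q, hp, hq, hx.trans_le (min_le_left _ _), hy.trans_le (min_le_left _ _),
    hpq.trans_le (min_le_left _ _), hR _ _ hp (hx.trans_le (min_le_right _ _))⟩

theorem superJet_comp_add_right {a : Eucl n} (h : (x, p) ∈ superJet univ fun y => f (y + a)) :
    (x + a, p) ∈ superJet univ f := by
  rw [mem_superJet_iff] at h ⊢
  obtain ⟨-, φ, hφ, ⟨r, hr, h⟩, hg⟩ := h
  refine ⟨mem_univ _, fun y => φ (y + -a), hφ.comp (contDiff_id.add contDiff_const),
    ⟨r, hr, fun y _ hd => ?_⟩, ?_⟩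
  · have := h (y + -a) (mem_univ _) (by
      rw [dist_eq_norm] at hd ⊢
      rwa [show y + -a - x = y - (x + a) by abel])
    simpa using this
  · rw [gradient_comp_add_right, add_neg_cancel_right, hg]

/-- Doubling of variables with an inward shift, at a maximum of `f - g` over the closure of an open
set. -/
theorem exists_mem_closure_superJet_subJet_of_inward {Ω : Set (Eucl n)} (hΩ : IsOpen Ω)
    (hΩc : IsCompact (closure Ω)) (hf : ContinuousOn f (closure Ω)) (hg : ContinuousOn g (closure Ω))
    (hx₀ : x₀ ∈ closure Ω) {ν : Eucl n} {r : ℝ} (hr : 0 < r)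
    (hin : ∀ y ∈ closure Ω, dist y x₀ < r → ∀ t : ℝ, 0 < t → t < r → y + t • ν ∈ Ω)
    (hmax : ∀ y ∈ closure Ω, f y - g y ≤ f x₀ - g x₀)
    {R : ℝ} (hR : ∀ x p, (x, p) ∈ superJet Ω f → ‖p‖ ≤ R) :
    ∃ p, (x₀, p) ∈ closure (superJet Ω f) ∧ (x₀, p) ∈ closure (subJet (closure Ω) g) := by
  suffices h : ∀ η > 0, ∃ x p y q, (x, p) ∈ superJet Ω f ∧ (y, q) ∈ subJet (closure Ω) g ∧
      dist x x₀ < η ∧ dist y x₀ < η ∧ ‖p - q - 0‖ < η ∧ ‖p‖ ≤ R by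
    obtain ⟨p, -, h1, h2⟩ := exists_mem_closure_of_near h
    exact ⟨p, h1, by simpa using h2⟩
  intro η hη
  set s := min (r / 2) (η / 8) with hs
  have hspos : 0 < s := by positivity
  have hsr : s ≤ r / 2 := min_le_left _ _
  have hsη : s ≤ η / 8 := min_le_right _ _
  -- Replacing `f` by its translate `f (· + δ • ν)` puts the first variable inside `Ω`. The
  -- translation changes `f` by less than `s²/4` at each of the two points compared, so the penalty
  -- `‖y - x₀‖²` keeps the new maximizer within `s` of `x₀`.
  obtain ⟨d, hd, hunif⟩ := Metric.uniformContinuousOn_iff.1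
    (hΩc.uniformContinuousOn_of_continuous hf) (s ^ 2 / 4) (by positivity)
  obtain ⟨δ, hδ0, hδr, hδν⟩ : ∃ δ > 0, δ < r ∧ δ * ‖ν‖ < min d (η / 2) := by
    have h1 : ∀ᶠ t : ℝ in 𝓝[>] 0, t * ‖ν‖ < min d (η / 2) := by
      have : ContinuousAt (fun t : ℝ => t * ‖ν‖) 0 := by fun_prop
      exact (this.eventually_lt continuousAt_const (by simpa using ⟨hd, hη⟩)).filter_mono
        nhdsWithin_le_nhds
    have h2 : ∀ᶠ t : ℝ in 𝓝[>] 0, t < r := (eventually_lt_nhds hr).filter_mono nhdsWithin_le_nhds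
    obtain ⟨t, ⟨h1, h2⟩, h3⟩ := ((h1.and h2).and self_mem_nhdsWithin).exists
    exact ⟨t, h3, h2, h1⟩
  have hδn : ‖δ • ν‖ < min d (η / 2) := by rwa [norm_smul, Real.norm_of_nonneg hδ0.le]
  have hball : ∀ y ∈ closure Ω ∩ Metric.closedBall x₀ s, y + δ • ν ∈ Ω := fun y hy =>
    hin y hy.1 (lt_of_le_of_lt hy.2 (by linarith)) δ hδ0 hδr
  have hclose : ∀ y ∈ closure Ω ∩ Metric.closedBall x₀ s, |f (y + δ • ν) - f y| < s ^ 2 / 4 := by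
    intro y hy
    refine hunif _ (subset_closure (hball y hy)) _ hy.1 ?_
    rw [dist_eq_norm, add_sub_cancel_left]
    exact hδn.trans_le (min_le_left _ _)
  have hcpt : IsCompact (closure Ω ∩ Metric.closedBall x₀ s) :=
    hΩc.inter_right Metric.isClosed_closedBall
  have hxm : x₀ ∈ closure Ω ∩ Metric.closedBall x₀ s := ⟨hx₀, Metric.mem_closedBall_self hspos.le⟩
  have hfδ : ContinuousOn (fun y => f (y + δ • ν)) (closure Ω ∩ Metric.closedBall x₀ s) :=
    hf.comp (by fun_prop) fun y hy => subset_closure (hball y hy)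
  obtain ⟨xh, hxh, hxhmax⟩ := hcpt.exists_isMaxOn ⟨x₀, hxm⟩
    ((hfδ.sub (hg.mono inter_subset_left)).sub
      (contDiff_const_mul_norm_sub_sq 1 x₀).continuous.continuousOn)
  have h1 := hxhmax hxm
  simp only [mem_ofPred_eq, sub_self, norm_zero, Pi.sub_apply] at h1
  have h2 := abs_lt.1 (hclose _ hxh)
  have h3 := abs_lt.1 (hclose _ hxm)
  have h4 := hmax _ hxh.1
  have hxhs : dist xh x₀ < s := by
    rw [dist_eq_norm]
    refine lt_of_pow_lt_pow_left₀ 2 hspos.le ?_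
    have : 0 < s ^ 2 := by positivity
    linarith
  have hopen : IsOpen {x : Eucl n | x + δ • ν ∈ Ω} := hΩ.preimage (by fun_prop)
  obtain ⟨ρ', hρ', hρU⟩ := Metric.isOpen_iff.1 hopen xh (hball _ hxh)
  set ρ := min (ρ' / 2) ((s - dist xh x₀) / 2) with hρ
  have hρpos : 0 < ρ := lt_min (by positivity) (by linarith)
  have hρ1 : ρ ≤ ρ' / 2 := min_le_left _ _
  have hρ2 : ρ ≤ (s - dist xh x₀) / 2 := min_le_right _ _
  have hsub : Metric.closedBall xh ρ ⊆ {x : Eucl n | x + δ • ν ∈ Ω} :=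
    (Metric.closedBall_subset_ball (by linarith)).trans hρU
  obtain ⟨x, p, y, q, hp, hq, hx, hy, hpq⟩ := exists_superJet_subJet_near
    (f := fun y => f (y + δ • ν)) (g := g) isClosed_closure hxh.1 hρpos
    (hf.comp (by fun_prop) fun y hy => subset_closure (hsub hy)) (hg.mono inter_subset_left)
    (contDiff_const_mul_norm_sub_sq 1 x₀)
    (fun y hy => hxhmax ⟨hy.1, show dist y x₀ ≤ s by
      have : dist y xh ≤ ρ := hy.2
      linarith [dist_triangle y xh x₀]⟩)
    (lt_min (show 0 < η / 4 by positivity) hρpos)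
  have hxΩ : x + δ • ν ∈ Ω := hsub (hx.trans_le (min_le_right _ _)).le
  have hpΩ := superJet_mono (subset_univ Ω) hxΩ (superJet_comp_add_right hp)
  have hxη := hx.trans_le (min_le_left (η / 4) ρ)
  have hyη := hy.trans_le (min_le_left (η / 4) ρ)
  refine ⟨x + δ • ν, p, y, q, hpΩ, hq, ?_, ?_, ?_, hR _ _ hpΩ⟩
  · have e1 : dist (x + δ • ν) x < η / 2 := by
      rw [dist_eq_norm, add_sub_cancel_left]; exact hδn.trans_le (min_le_right _ _)
    linarith [dist_triangle (x + δ • ν) x x₀, dist_triangle x xh x₀]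
  · linarith [dist_triangle y xh x₀]
  · rw [gradient_const_mul_norm_sub_sq] at hpq
    have h6 : ‖(2 * 1 : ℝ) • (xh - x₀)‖ ≤ η / 4 := by
      rw [norm_smul, ← dist_eq_norm]; norm_num; linarith
    calc _ = ‖(p - q - (2 * 1 : ℝ) • (xh - x₀)) + (2 * 1 : ℝ) • (xh - x₀)‖ := by congr 1; abel
      _ ≤ _ := norm_add_le _ _
      _ < η / 4 + η / 4 := add_lt_add_of_lt_of_le (hpq.trans_le (min_le_left _ _)) h6
      _ ≤ η := by linarith

/-- A bound for the superdifferential gives a Lipschitz-type bound along segments. -/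
theorem sub_le_of_superJet_bound (hU : IsOpen U) (hf : ContinuousOn f U) {L : ℝ} (hL : 0 ≤ L)
    (h : ∀ x p, (x, p) ∈ superJet U f → ‖p‖ ≤ L) {a b : Eucl n} (hab : segment ℝ a b ⊆ U) :
    f b - f a ≤ L * ‖b - a‖ := by
  -- Subtract the cone `L'‖y - x‖ + B‖y - x‖²`: a maximizer other than the vertex would produce a
  -- superdifferential of norm above `L`, so the vertex is the maximizer.
  have loc : ∀ x ∈ U, ∀ L' > L, ∃ r > 0, ∃ B ≥ 0, ∀ y, dist y x < r →
      f y ≤ f x + L' * ‖y - x‖ + B * ‖y - x‖ ^ 2 := by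
    intro x hx L' hL'
    have hL0 : 0 < L' := hL.trans_lt hL'
    obtain ⟨r', hr', hrU'⟩ := Metric.isOpen_iff.1 hU x hx
    set r := r' / 2
    have hr : 0 < r := by positivity
    have hrU : Metric.closedBall x r ⊆ U :=
      (Metric.closedBall_subset_ball (by simp only [r]; linarith)).trans hrU'
    have hfr := hf.mono hrU
    obtain ⟨M, hM⟩ := (isCompact_closedBall x r).exists_bound_of_continuousOn hfr
    have hxm : x ∈ Metric.closedBall x r := Metric.mem_closedBall_self hr.le
    have hM0 : 0 ≤ M := (norm_nonneg _).trans (hM x hxm)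
    set B := (2 * M + 1) / r ^ 2
    have hBr : B * r ^ 2 = 2 * M + 1 := by simp only [B]; field_simp
    have hB : 0 ≤ B := by positivity
    refine ⟨r, hr, B, hB, fun y hy => ?_⟩
    obtain ⟨z, hz, hzmax⟩ := (isCompact_closedBall x r).exists_isMaxOn ⟨x, hxm⟩
      (hfr.sub (show ContinuousOn (fun y => L' * ‖y - x‖ + B * ‖y - x‖ ^ 2)
        (Metric.closedBall x r) by fun_prop))
    have hzx : z = x := by
      by_contra hne
      have hpos : 0 < ‖z - x‖ := norm_pos_iff.2 (sub_ne_zero.2 hne)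
      have h1 := hzmax hxm
      simp only [mem_ofPred_eq, sub_self, norm_zero, Pi.sub_apply] at h1
      have h2 := abs_le.1 (hM x hxm)
      have h3 := abs_le.1 (hM z hz)
      have hzr : dist z x < r := by
        refine lt_of_le_of_ne hz fun he => ?_
        rw [← dist_eq_norm, he] at h1
        nlinarith
      -- The cone is replaced by a smooth paraboloid centred at `x` which, up to a constant, lies
      -- above it and touches it at `z`, by completing the square in `t = ‖y - x‖`.
      have := h z _ (mem_superJet_iff.2 ⟨hrU hz, _,
        contDiff_const_mul_norm_sub_sq (L' / (2 * ‖z - x‖) + B) x,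
        ⟨r - dist z x, by linarith, fun y _ hyd => ?_⟩, rfl⟩)
      · rw [gradient_const_mul_norm_sub_sq, norm_smul, Real.norm_of_nonneg (by positivity)] at this
        have e : 2 * (L' / (2 * ‖z - x‖) + B) * ‖z - x‖ = L' + 2 * B * ‖z - x‖ := by
          field_simp
        rw [e] at this
        nlinarith [mul_nonneg hB hpos.le]
      · have h4 := hzmax (show y ∈ Metric.closedBall x r from
          show dist y x ≤ r by linarith [dist_triangle y z x])
        simp only [mem_ofPred_eq, Pi.sub_apply] at h4
        have e : ∀ t : ℝ, (L' / (2 * ‖z - x‖) + B) * t ^ 2 =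
            L' * t + B * t ^ 2 + L' / (2 * ‖z - x‖) * (t - ‖z - x‖) ^ 2 - L' * ‖z - x‖ / 2 := by
          intro t; field_simp; ring
        rw [e, e]
        have : 0 ≤ L' / (2 * ‖z - x‖) * (‖y - x‖ - ‖z - x‖) ^ 2 := by positivity
        nlinarith
    subst hzx
    have h4 := hzmax (show y ∈ Metric.closedBall z r from hy.le)
    simp only [mem_ofPred_eq, sub_self, norm_zero, Pi.sub_apply] at h4
    linarith
  set c : ℝ → Eucl n := fun t => a + t • (b - a) with hc
  have hcc : Continuous c := by fun_prop
  have hcU : ∀ t ∈ Icc (0 : ℝ) 1, c t ∈ U := fun t ht => hab <| by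
    rw [segment_eq_image']; exact ⟨t, ht, rfl⟩
  -- The local bound controls right difference quotients along the segment by any slope above `L *
  -- ‖b - a‖`; a mean value inequality for such slopes integrates it.
  have main := image_le_of_liminf_slope_right_le_deriv_boundary (a := 0) (b := 1)
    (f := fun t => f (c t)) (B := fun t => f a + t * (L * ‖b - a‖))
    (B' := fun _ => L * ‖b - a‖)
    (hf.comp hcc.continuousOn hcU) (by simp [hc]) (by fun_prop)
    (fun t _ => by
      simpa using (((hasDerivAt_id t).mul_const (L * ‖b - a‖)).const_add (f a)).hasDerivWithinAt)
    (fun t ht s hs => ?_) (right_mem_Icc.2 zero_le_one)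
  · simp only [hc, one_smul, one_mul, add_sub_cancel] at main
    linarith
  · obtain ⟨L', hL', hs'⟩ : ∃ L' > L, L' * ‖b - a‖ < s := by
      have : ContinuousAt (fun l : ℝ => l * ‖b - a‖) L := by fun_prop
      have h1 : ∀ᶠ l in 𝓝[>] L, l * ‖b - a‖ < s :=
        (this.eventually_lt continuousAt_const hs).filter_mono nhdsWithin_le_nhds
      obtain ⟨l, hl, hl'⟩ := (h1.and self_mem_nhdsWithin).exists
      exact ⟨l, hl', hl⟩
    obtain ⟨r, hr, B, hB, hloc⟩ := loc (c t) (hcU t ⟨ht.1, ht.2.le⟩) L' hL'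
    have e1 : ∀ᶠ z in 𝓝[>] t, dist (c z) (c t) < r :=
      (Metric.tendsto_nhds.1 hcc.continuousAt r hr).filter_mono nhdsWithin_le_nhds
    have e2 : ∀ᶠ z in 𝓝[>] t, L' * ‖b - a‖ + B * (z - t) * ‖b - a‖ ^ 2 < s := by
      have : ContinuousAt (fun z : ℝ => L' * ‖b - a‖ + B * (z - t) * ‖b - a‖ ^ 2) t := by fun_prop
      exact (this.eventually_lt continuousAt_const (by simpa using hs')).filter_mono
        nhdsWithin_le_nhds
    refine Eventually.frequently ?_
    filter_upwards [e1, e2, self_mem_nhdsWithin] with z h1 h2 h3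
    have hzt : 0 < z - t := sub_pos.2 h3
    have h4 := hloc _ h1
    have h5 : c z - c t = (z - t) • (b - a) := by simp only [hc]; module
    rw [h5, norm_smul, Real.norm_of_nonneg hzt.le] at h4
    rw [slope_def_field, div_lt_iff₀ hzt]
    nlinarith

end Doubling

/-! ### An Arzelà–Ascoli theorem along ultrafilters. -/

section Ascoli

variable {n : ℕ} {ι : Type*}

/-- An equicontinuous pointwise bounded family converges locally uniformly along an ultrafilter. -/
theorem exists_tendstoLocallyUniformlyOn_ultrafilter (𝓤 : Ultrafilter ι) {F : ι → Eucl n → ℝ}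
    {K : Set (Eucl n)} (hbdd : ∀ x ∈ K, ∃ M, ∀ᶠ s in (𝓤 : Filter ι), |F s x| ≤ M)
    (hequi : ∀ x ∈ K, ∀ η > 0, ∃ r > 0, ∀ᶠ s in (𝓤 : Filter ι), ∀ y ∈ K, dist y x < r →
      |F s y - F s x| ≤ η) :
    ∃ f, TendstoLocallyUniformlyOn F f 𝓤 K := by
  -- Along an ultrafilter every bounded real family converges, so no diagonal extraction is needed.
  have : ∀ x, ∃ l, x ∈ K → Tendsto (fun s => F s x) 𝓤 (𝓝 l) := by
    intro x
    by_cases hx : x ∈ K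
    · obtain ⟨M, hM⟩ := hbdd x hx
      obtain ⟨l, -, hl⟩ := isCompact_Icc.ultrafilter_le_nhds (𝓤.map fun s => F s x)
        (by
          rw [le_principal_iff]
          change (fun s => F s x) ⁻¹' Icc (-M) M ∈ (𝓤 : Filter ι)
          filter_upwards [hM] with s hs using abs_le.1 hs)
      exact ⟨l, fun _ => hl⟩
    · exact ⟨0, fun h => absurd h hx⟩
  choose f hf using this
  refine ⟨f, Metric.tendstoLocallyUniformlyOn_iff.2 fun η hη x hx => ?_⟩
  obtain ⟨r, hr, hev⟩ := hequi x hx (η / 4) (by positivity)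
  have hlim : ∀ y ∈ K, dist y x < r → |f y - f x| ≤ η / 4 := fun y hy hd =>
    le_of_tendsto ((hf y hy).sub (hf x hx)).abs (by filter_upwards [hev] with s hs using hs y hy hd)
  refine ⟨Metric.ball x r ∩ K, inter_mem (mem_nhdsWithin_of_mem_nhds (Metric.ball_mem_nhds x hr)) self_mem_nhdsWithin, ?_⟩
  filter_upwards [hev, Metric.tendsto_nhds.1 (hf x hx) (η / 4) (by positivity)] with s h1 h2 y hy
  have h3 := abs_le.1 (h1 y hy.2 hy.1)
  have h4 := abs_le.1 (hlim y hy.2 hy.1)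
  rw [Real.dist_eq, abs_lt] at h2 ⊢
  constructor <;> linarith

end Ascoli

/-! ### Periodic functions and uniform properties of the Hamiltonians. -/

section Periodic

variable {n : ℕ}

/-- The closed unit cube. -/
def unitCube (n : ℕ) : Set (Eucl n) := {x | ∀ i, x i ∈ Icc (0 : ℝ) 1}

theorem isCompact_unitCube : IsCompact (unitCube n) := by
  have h : IsCompact (Set.pi univ fun _ : Fin n => Icc (0 : ℝ) 1) :=
    isCompact_univ_pi fun _ => isCompact_Icc
  have h2 := h.image (PiLp.continuous_toLp 2 (fun _ : Fin n => ℝ))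
  convert h2 using 1
  ext x
  constructor
  · intro hx
    exact ⟨WithLp.ofLp x, fun i _ => hx i, rfl⟩
  · rintro ⟨y, hy, rfl⟩ i
    exact hy i (mem_univ i)

theorem exists_int_translate_mem_unitCube (x : Eucl n) :
    ∃ z : Fin n → ℤ, x + WithLp.toLp 2 (fun i => (z i : ℝ)) ∈ unitCube n := by
  refine ⟨fun i => -⌊x i⌋, fun i => ?_⟩
  have h1 := Int.floor_le (x i)
  have h2 := Int.lt_floor_add_one (x i)
  simp only [PiLp.add_apply, Int.cast_neg]
  exact ⟨by linarith, by linarith⟩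

theorem zero_mem_unitCube : (0 : Eucl n) ∈ unitCube n := fun _ => by simp

theorem IsZPeriodic.exists_forall_le {f : Eucl n → ℝ} (hf : Continuous f) (hp : IsZPeriodic f) :
    ∃ x, ∀ y, f y ≤ f x := by
  obtain ⟨x, -, hx⟩ := isCompact_unitCube.exists_isMaxOn ⟨0, zero_mem_unitCube⟩ hf.continuousOn
  refine ⟨x, fun y => ?_⟩
  obtain ⟨z, hz⟩ := exists_int_translate_mem_unitCube y
  rw [← hp y z]
  exact hx hz

theorem IsZPeriodic.exists_abs_le {f : Eucl n → ℝ} (hf : Continuous f) (hp : IsZPeriodic f) :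
    ∃ M, ∀ y, |f y| ≤ M := by
  obtain ⟨x, hx⟩ := IsZPeriodic.exists_forall_le hf.abs
    (fun y z => by simp only [hp y z] : IsZPeriodic fun y => |f y|)
  exact ⟨_, hx⟩

/-- Continuous, coercive and periodic Hamiltonians. -/
structure IsPeriodicCoercive (H : Eucl n → Eucl n → ℝ) : Prop where
  cont : Continuous (Function.uncurry H)
  coercive : IsCoerciveHamiltonian H
  periodic : IsZPeriodic H

namespace IsPeriodicCoercive

variable {H : Eucl n → Eucl n → ℝ}

theorem shift (hH : IsPeriodicCoercive H) (P : Eucl n) : IsPeriodicCoercive fun ξ p => H ξ (P + p) where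
  cont := hH.cont.comp (continuous_fst.prodMk (continuous_const.add continuous_snd))
  coercive := fun C => by
    obtain ⟨r, hr⟩ := hH.coercive C
    refine ⟨r + ‖P‖, fun ξ p hp => hr ξ _ ?_⟩
    have : ‖p‖ ≤ ‖P + p‖ + ‖P‖ := by
      simpa using norm_sub_le (P + p) P
    linarith
  periodic := fun x z => by
    funext p
    simp only [hH.periodic x z]

theorem exists_abs_le (hH : IsPeriodicCoercive H) (R : ℝ) : ∃ M, ∀ ξ p : Eucl n, ‖p‖ ≤ R → |H ξ p| ≤ M := by
  obtain ⟨M, hM⟩ := (isCompact_unitCube.prod (isCompact_closedBall (0 : Eucl n) R)).exists_bound_of_continuousOn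
    hH.cont.continuousOn
  refine ⟨M, fun ξ p hp => ?_⟩
  obtain ⟨z, hz⟩ := exists_int_translate_mem_unitCube ξ
  rw [← hH.periodic ξ z]
  exact hM (_, p) ⟨hz, mem_closedBall_zero_iff.2 hp⟩

theorem exists_forall_ge (hH : IsPeriodicCoercive H) : ∃ m, ∀ ξ p : Eucl n, -m ≤ H ξ p := by
  obtain ⟨r, hr⟩ := hH.coercive 0
  obtain ⟨M, hM⟩ := hH.exists_abs_le r
  refine ⟨max M 0, fun ξ p => ?_⟩
  rcases le_total r ‖p‖ with h | h
  · linarith [hr ξ p h, le_max_right M 0]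
  · linarith [(abs_le.1 (hM ξ p h)).1, le_max_left M 0]

theorem exists_norm_le (hH : IsPeriodicCoercive H) (C : ℝ) : ∃ R, 0 ≤ R ∧ ∀ ξ p : Eucl n, H ξ p ≤ C → ‖p‖ ≤ R := by
  obtain ⟨r, hr⟩ := hH.coercive (C + 1)
  refine ⟨max r 0, le_max_right _ _, fun ξ p h => ?_⟩
  by_contra! hcon
  linarith [hr ξ p ((le_max_left _ _).trans hcon.le)]

theorem exists_modulus (hH : IsPeriodicCoercive H) (R : ℝ) {θ : ℝ} (hθ : 0 < θ) :
    ∃ δ > 0, ∀ ξ p q : Eucl n, ‖p‖ ≤ R → ‖p - q‖ < δ → |H ξ p - H ξ q| < θ := by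
  obtain ⟨δ, hδ, h⟩ := Metric.uniformContinuousOn_iff.1
    ((isCompact_unitCube.prod (isCompact_closedBall (0 : Eucl n) (R + 1))).uniformContinuousOn_of_continuous
    hH.cont.continuousOn) θ hθ
  -- Keeping `δ ≤ 1` places `q` in the ball of radius `R + 1` on which uniform continuity was taken.
  refine ⟨min δ 1, by positivity, fun ξ p q hp hpq => ?_⟩
  obtain ⟨z, hz⟩ := exists_int_translate_mem_unitCube ξ
  rw [← hH.periodic ξ z]
  have hq : ‖q‖ ≤ R + 1 := by
    have h1 := hpq.trans_le (min_le_right _ _)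
    have h2 : ‖q‖ ≤ ‖p‖ + ‖p - q‖ := by simpa using norm_sub_le p (p - q)
    linarith
  refine h (_, p) ⟨hz, mem_closedBall_zero_iff.2 (by linarith)⟩ (_, q)
    ⟨hz, mem_closedBall_zero_iff.2 hq⟩ ?_
  rw [Prod.dist_eq]
  simp only [dist_self]
  rw [dist_eq_norm]
  exact max_lt hδ (hpq.trans_le (min_le_left _ _))

end IsPeriodicCoercive

/-- Components are indexed by `Bool`; this lets both share one nonnegative constant whenever the
bound can be weakened. -/
theorem exists_common_bound {p : Bool → ℝ → Prop} (hp : ∀ b M M', M ≤ M' → p b M → p b M')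
    (h : ∀ b, ∃ M, p b M) : ∃ M, 0 ≤ M ∧ ∀ b, p b M := by
  choose M hM using h
  refine ⟨max 0 (max (M true) (M false)), le_max_left _ _, fun b => hp b _ _ ?_ (hM b)⟩
  cases b
  · exact (le_max_right _ _).trans (le_max_right _ _)
  · exact (le_max_left _ _).trans (le_max_right _ _)

end Periodic

/-! ### Weakly coupled systems on the whole space. -/

section System

variable {n : ℕ}

/-- `v` is a subsolution of `lam vᵢ + Gᵢ(x, Dvᵢ) + vᵢ - vⱼ = c` in `ℝⁿ`. -/
def IsSystemSub (G : Bool → Eucl n → Eucl n → ℝ) (lam c : ℝ) (v : Bool → Eucl n → ℝ) : Prop :=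
  ∀ i x p, (x, p) ∈ superJet univ (v i) → lam * v i x + G i x p + v i x - v (!i) x ≤ c

/-- `v` is a supersolution of `lam vᵢ + Gᵢ(x, Dvᵢ) + vᵢ - vⱼ = c` in `ℝⁿ`. -/
def IsSystemSuper (G : Bool → Eucl n → Eucl n → ℝ) (lam c : ℝ) (v : Bool → Eucl n → ℝ) : Prop :=
  ∀ i x p, (x, p) ∈ subJet univ (v i) → c ≤ lam * v i x + G i x p + v i x - v (!i) x

variable {G : Bool → Eucl n → Eucl n → ℝ} {lam c : ℝ} {v : Bool → Eucl n → ℝ}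

/-- Reflection exchanges the two notions because the coupling is linear; it transfers stability from
subsolutions to supersolutions. -/
theorem isSystemSuper_iff_neg : IsSystemSuper G lam c v ↔
    IsSystemSub (fun i x p => -G i x (-p)) lam (-c) (fun i x => -v i x) := by
  constructor
  · intro h i x p hp
    have := h i x (-p) (mem_subJet_iff_neg.2 (by simpa using hp))
    linarith
  · intro h i x p hp
    have := h i x (-p) (mem_subJet_iff_neg.1 hp)
    simp only [neg_neg] at this
    linarith

/-- The difference of the two test functions has a local minimum at `x`, so its gradient vanishes.
-/
theorem superJet_subJet_unique {f : Eucl n → ℝ} {x p q : Eucl n} (hp : (x, p) ∈ superJet univ f)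
    (hq : (x, q) ∈ subJet univ f) : p = q := by
  obtain ⟨-, φ, hφ, ⟨r, hr, hmax⟩, rfl⟩ := mem_superJet_iff.1 hp
  obtain ⟨-, ψ, hψ, ⟨s, hs, hmin⟩, rfl⟩ := mem_subJet_iff.1 hq
  have hloc : IsLocalMin (fun y => φ y - ψ y) x := by
    filter_upwards [Metric.ball_mem_nhds x hr, Metric.ball_mem_nhds x hs] with y h1 h2
    linarith [hmax y (mem_univ _) h1, hmin y (mem_univ _) h2]
  have h0 : gradient (fun y => φ y - ψ y) x = 0 := by
    simp only [gradient, hloc.fderiv_eq_zero, map_zero]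
  rw [gradient_fun_sub hφ hψ] at h0
  exact sub_eq_zero.1 h0

theorem mem_superJet_of_forall_le {f : Eucl n → ℝ} {x : Eucl n} (h : ∀ y, f y ≤ f x) :
    (x, 0) ∈ superJet univ f :=
  mem_superJet_iff.2 ⟨mem_univ _, fun _ => 0, contDiff_const,
    ⟨1, one_pos, fun y _ _ => by simpa using h y⟩, gradient_fun_const _ _⟩

theorem mem_subJet_of_forall_ge {f : Eucl n → ℝ} {x : Eucl n} (h : ∀ y, f x ≤ f y) :
    (x, 0) ∈ subJet univ f :=
  mem_subJet_iff.2 ⟨mem_univ _, fun _ => 0, contDiff_const,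
    ⟨1, one_pos, fun y _ _ => by simpa using h y⟩, gradient_fun_const _ _⟩

/-- A pointwise inequality that holds wherever the superdifferential is nonempty holds everywhere. -/
theorem le_of_superJet {U : Set (Eucl n)} (hU : IsOpen U) {f F : Eucl n → ℝ} (hf : ContinuousOn f U)
    (hF : ContinuousOn F U) {C : ℝ} (h : ∀ x p, x ∈ U → (x, p) ∈ superJet univ f → F x ≤ C)
    {x : Eucl n} (hx : x ∈ U) : F x ≤ C := by
  by_contra! hcon
  have hev : ∀ᶠ y in 𝓝 x, y ∈ U ∧ C < F y :=
    (hU.eventually_mem hx).and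
      (continuousAt_const.eventually_lt (hF.continuousAt (hU.mem_nhds hx)) hcon)
  obtain ⟨r, hr, hrU⟩ := Metric.eventually_nhds_iff.1 hev
  have hsub : Metric.closedBall x (r / 2) ⊆ U := fun y hy =>
    (hrU (lt_of_le_of_lt hy (by linarith))).1
  obtain ⟨y, q, hq, hy⟩ := exists_superJet_of_continuousOn (half_pos hr) (hf.mono hsub)
  have := hrU (show dist y x < r by linarith)
  linarith [h y q this.1 hq]

/-- The equation and `G ≥ -m` give the bound at points with a superdifferential; these are dense and
both sides are continuous. -/
theorem IsSystemSub.sub_le (h : IsSystemSub G lam c v) (hv : ∀ i, Continuous (v i)) {m C : ℝ}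
    (hm : ∀ i x p, -m ≤ G i x p) (hC : ∀ i x, -C ≤ lam * v i x) (i : Bool) (x : Eucl n) :
    v i x - v (!i) x ≤ c + C + m := by
  refine le_of_superJet (F := fun x => v i x - v (!i) x) isOpen_univ (hv i).continuousOn
    ((hv i).sub (hv !i)).continuousOn (fun y p _ hp => ?_) (mem_univ x)
  linarith [h i y p hp, hm i y p, hC i y]

/-- The coupling term is controlled by `sub_le` for the other component. With coercivity this
becomes a gradient bound depending on `lam` only through the bound on `lam * v`. -/
theorem IsSystemSub.hamiltonian_le (h : IsSystemSub G lam c v) (hv : ∀ i, Continuous (v i))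
    {m C : ℝ} (hm : ∀ i x p, -m ≤ G i x p) (hC : ∀ i x, -C ≤ lam * v i x) {i : Bool}
    {x p : Eucl n} (hp : (x, p) ∈ superJet univ (v i)) : G i x p ≤ 2 * c + 2 * C + m := by
  have h1 := h.sub_le hv hm hC (!i) x
  rw [Bool.not_not] at h1
  linarith [h i x p hp, hC i x]

/-- Stability of subsolutions under uniform convergence on balls. -/
theorem IsSystemSub.of_tendsto {ι : Type*} {l : Filter ι} [l.NeBot]
    (hG : ∀ i, Continuous (Function.uncurry (G i))) {lams cs : ι → ℝ} {vs : ι → Bool → Eucl n → ℝ}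
    (hlam : Tendsto lams l (𝓝 lam)) (hc : Tendsto cs l (𝓝 c)) (hv : ∀ i, Continuous (v i))
    (hlim : ∀ i x, TendstoUniformlyOn (fun s => vs s i) (v i) l (Metric.closedBall x 1))
    (hcont : ∀ᶠ s in l, ∀ i, Continuous (vs s i))
    (hsub : ∀ᶠ s in l, IsSystemSub G (lams s) (cs s) (vs s)) : IsSystemSub G lam c v := by
  intro i x p hp
  -- Choose jets and indices with errors below `1 / (k + 1)`, so that the inequality passes to the
  -- limit along a sequence.
  have key : ∀ k : ℕ, ∃ y q s, dist y x < 1 / ((k : ℝ) + 1) ∧ ‖q - p‖ < 1 / ((k : ℝ) + 1) ∧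
      |lams s - lam| < 1 / ((k : ℝ) + 1) ∧ |cs s - c| < 1 / ((k : ℝ) + 1) ∧
      (∀ j, |vs s j y - v j y| < 1 / ((k : ℝ) + 1)) ∧
      lams s * vs s i y + G i y q + vs s i y - vs s (!i) y ≤ cs s := by
    intro k
    have hk : 0 < 1 / ((k : ℝ) + 1) := by positivity
    have hk1 : 1 / ((k : ℝ) + 1) ≤ 1 := by
      rw [div_le_one (by positivity)]
      have : (0 : ℝ) ≤ k := k.cast_nonneg
      linarith
    obtain ⟨r, hr, hrk, ρ, hρ, hρk, hstab⟩ := exists_superJet_near isClosed_univ hp hk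
    have hu : ∀ᶠ s in l, ∀ j, ∀ y ∈ Metric.closedBall x 1, dist (v j y) (vs s j y) < ρ := by
      rw [eventually_all]
      exact fun j => Metric.tendstoUniformlyOn_iff.1 (hlim j x) ρ hρ
    obtain ⟨s, ⟨⟨h1, h2⟩, h3, h4⟩, h5⟩ := ((((Metric.tendsto_nhds.1 hlam _ hk).and
      (Metric.tendsto_nhds.1 hc _ hk)).and (hcont.and hsub)).and hu).exists
    have h6 : ∀ j, ∀ y ∈ Metric.closedBall x r, |vs s j y - v j y| < ρ := fun j y hy => by
      have := h5 j y (Metric.closedBall_subset_closedBall (hrk.trans hk1) hy)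
      rwa [Real.dist_eq, abs_sub_comm] at this
    obtain ⟨y, q, hq, hy, hqp, -⟩ := hstab (vs s i) (h3 i).continuousOn
      (fun y hy => by linarith [(abs_lt.1 (h6 i y hy.2)).2])
      (by linarith [(abs_lt.1 (h6 i x (Metric.mem_closedBall_self hr.le))).1])
    exact ⟨y, q, s, hy.trans_le hrk, hqp, h1, h2,
      fun j => (h6 j y hy.le).trans_le hρk, h4 i y q hq⟩
  choose y q s hy hq hl hcs hvs hle using key
  have h0 : Tendsto (fun k : ℕ => 1 / ((k : ℝ) + 1)) atTop (𝓝 0) :=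
    tendsto_one_div_add_atTop_nhds_zero_nat
  have ty : Tendsto y atTop (𝓝 x) := tendsto_iff_dist_tendsto_zero.2
    (squeeze_zero (fun _ => dist_nonneg) (fun k => (hy k).le) h0)
  have tq : Tendsto q atTop (𝓝 p) := tendsto_iff_norm_sub_tendsto_zero.2
    (squeeze_zero (fun _ => norm_nonneg _) (fun k => (hq k).le) h0)
  have tl : Tendsto (fun k => lams (s k)) atTop (𝓝 lam) := tendsto_iff_norm_sub_tendsto_zero.2
    (squeeze_zero (fun _ => norm_nonneg _) (fun k => (hl k).le) h0)
  have tc : Tendsto (fun k => cs (s k)) atTop (𝓝 c) := tendsto_iff_norm_sub_tendsto_zero.2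
    (squeeze_zero (fun _ => norm_nonneg _) (fun k => (hcs k).le) h0)
  have tv : ∀ j, Tendsto (fun k => vs (s k) j (y k)) atTop (𝓝 (v j x)) := fun j => by
    have h1 : Tendsto (fun k => vs (s k) j (y k) - v j (y k)) atTop (𝓝 0) :=
      tendsto_zero_iff_norm_tendsto_zero.2
        (squeeze_zero (fun _ => norm_nonneg _) (fun k => (hvs k j).le) h0)
    simpa using h1.add (((hv j).tendsto x).comp ty)
  have tG : Tendsto (fun k => G i (y k) (q k)) atTop (𝓝 (G i x p)) :=
    ((hG i).tendsto (x, p)).comp (ty.prodMk_nhds tq)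
  exact le_of_tendsto_of_tendsto' ((((tl.mul (tv i)).add tG).add (tv i)).sub (tv !i)) tc hle

end System

/-! ### Perron's method for the discounted system. -/

section Perron

variable {n : ℕ} {G : Bool → Eucl n → Eucl n → ℝ} {lam C : ℝ}

/-- The bounded continuous subsolutions of the discounted system. -/
def perronFamily (G : Bool → Eucl n → Eucl n → ℝ) (lam C : ℝ) : Set (Bool → Eucl n → ℝ) :=
  {v | (∀ i, Continuous (v i)) ∧ (∀ i x, |lam * v i x| ≤ C) ∧ IsSystemSub G lam 0 v}

/-- The supremum of the bounded continuous subsolutions of the discounted system. -/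
noncomputable def perronSup (G : Bool → Eucl n → Eucl n → ℝ) (lam C : ℝ) (i : Bool) (x : Eucl n) :
    ℝ :=
  ⨆ v : perronFamily G lam C, v.1 i x

theorem lipschitz_of_superJet_bound {f : Eucl n → ℝ} (hf : Continuous f) {L : ℝ} (hL : 0 ≤ L)
    (h : ∀ x p, (x, p) ∈ superJet univ f → ‖p‖ ≤ L) (x y : Eucl n) : f x ≤ f y + L * ‖x - y‖ := by
  linarith [sub_le_of_superJet_bound isOpen_univ hf.continuousOn hL h (subset_univ (segment ℝ y x))]

theorem continuous_of_le_add_mul_norm {f : Eucl n → ℝ} {L : ℝ} (hL : 0 ≤ L)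
    (h : ∀ x y, f x ≤ f y + L * ‖x - y‖) : Continuous f := by
  have : LipschitzWith L.toNNReal f := LipschitzWith.of_le_add_mul _ fun x y => by
    rw [Real.coe_toNNReal _ hL, dist_eq_norm]; exact h x y
  exact this.continuous

theorem le_perronSup (hlam : 0 < lam) {v : Bool → Eucl n → ℝ} (hv : v ∈ perronFamily G lam C)
    (i : Bool) (x : Eucl n) : v i x ≤ perronSup G lam C i x := by
  refine le_ciSup (f := fun v : perronFamily G lam C => v.1 i x) ⟨C / lam, ?_⟩ ⟨v, hv⟩
  rintro _ ⟨w, rfl⟩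
  rw [le_div_iff₀ hlam, mul_comm]
  exact (abs_le.1 (w.2.2.1 i x)).2

theorem const_mem_perronFamily (hlam : 0 < lam) (hC0 : 0 ≤ C) (hC : ∀ i x, |G i x 0| ≤ C) :
    (fun _ _ => -C / lam) ∈ perronFamily G lam C := by
  refine ⟨fun _ => continuous_const, fun _ _ => ?_, fun i x p hp => ?_⟩
  · rw [mul_div_cancel₀ _ hlam.ne', abs_neg, abs_of_nonneg hC0]
  · have h0 := superJet_subJet_unique hp (mem_subJet_of_forall_ge fun _ => le_rfl)
    subst h0
    have h1 : lam * (-C / lam) = -C := mul_div_cancel₀ _ hlam.ne'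
    linarith [(abs_le.1 (hC i x)).2]

theorem perronSup_le (hne : (perronFamily G lam C).Nonempty) {i : Bool} {x : Eucl n} {M : ℝ}
    (h : ∀ v ∈ perronFamily G lam C, v i x ≤ M) : perronSup G lam C i x ≤ M := by
  have := hne.to_subtype
  exact ciSup_le fun v => h v.1 v.2

theorem exists_lt_of_lt_perronSup (hne : (perronFamily G lam C).Nonempty) {i : Bool} {x : Eucl n}
    {M : ℝ} (h : M < perronSup G lam C i x) : ∃ v ∈ perronFamily G lam C, M < v i x := by
  have := hne.to_subtype
  obtain ⟨v, hv⟩ := exists_lt_of_lt_ciSup h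
  exact ⟨v.1, v.2, hv⟩

theorem abs_mul_perronSup_le (hlam : 0 < lam) (hne : (perronFamily G lam C).Nonempty) (i : Bool)
    (x : Eucl n) : |lam * perronSup G lam C i x| ≤ C := by
  rw [abs_le]
  constructor
  · obtain ⟨v, hv⟩ := hne
    have h1 := (abs_le.1 (hv.2.1 i x)).1
    have h2 := mul_le_mul_of_nonneg_left (le_perronSup hlam hv i x) hlam.le
    linarith
  · have : perronSup G lam C i x ≤ C / lam := perronSup_le hne fun v hv => by
      rw [le_div_iff₀ hlam, mul_comm]
      exact (abs_le.1 (hv.2.1 i x)).2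
    rwa [le_div_iff₀ hlam, mul_comm] at this

/-- Integer translations map the family into itself, although its members need not be periodic;
translating by `z` and `-z` gives both inequalities. -/
theorem perronSup_periodic (hper : ∀ i, IsZPeriodic (G i)) (hlam : 0 < lam)
    (hne : (perronFamily G lam C).Nonempty) (i : Bool) : IsZPeriodic (perronSup G lam C i) := by
  have key : ∀ (x : Eucl n) (z : Fin n → ℤ),
      perronSup G lam C i (x + WithLp.toLp 2 (fun i => (z i : ℝ))) ≤ perronSup G lam C i x := by
    intro x z
    refine perronSup_le hne fun v hv => ?_
    refine le_perronSup (v := fun i y => v i (y + WithLp.toLp 2 (fun i => (z i : ℝ)))) hlam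
      ⟨fun i => (hv.1 i).comp (continuous_id.add continuous_const), fun i x => hv.2.1 i _,
        fun i x p hp => ?_⟩ i x
    have := hv.2.2 i _ p (superJet_comp_add_right hp)
    rwa [hper i x z] at this
  intro x z
  refine le_antisymm (key x z) ?_
  have := key (x + WithLp.toLp 2 (fun i => (z i : ℝ))) (-z)
  have e : x + WithLp.toLp 2 (fun i => (z i : ℝ)) +
      WithLp.toLp 2 (fun i => (((-z) i : ℤ) : ℝ)) = x := by
    ext j
    simp
  rwa [e] at this

/-- One member nearly attaining the supremum at `x` suffices: it lies below the supremum everywhere,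
so the one-sided stability `exists_superJet_near` yields a nearby jet. Replacing the other component
by its supremum only lowers the left side. -/
theorem isSystemSub_perronSup (hG : ∀ i, Continuous (Function.uncurry (G i))) (hlam : 0 < lam)
    (hne : (perronFamily G lam C).Nonempty) (hcont : ∀ i, Continuous (perronSup G lam C i)) :
    IsSystemSub G lam 0 (perronSup G lam C) := by
  intro i x p hp
  set V := perronSup G lam C with hV
  by_contra! hcon
  have hΨ : Continuous fun z : (Eucl n × Eucl n) × ℝ =>
      (lam + 1) * (V i x - z.2) + G i z.1.1 z.1.2 - V (!i) z.1.1 :=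
    ((by fun_prop : Continuous fun z : (Eucl n × Eucl n) × ℝ => (lam + 1) * (V i x - z.2)).add
      ((hG i).comp continuous_fst)).sub
      ((hcont !i).comp (continuous_fst.comp continuous_fst))
  have hpos : ∀ᶠ z : (Eucl n × Eucl n) × ℝ in 𝓝 ((x, p), 0),
      0 < (lam + 1) * (V i x - z.2) + G i z.1.1 z.1.2 - V (!i) z.1.1 :=
    (continuous_const.tendsto _).eventually_lt (hΨ.tendsto _) (by simp only; linarith)
  obtain ⟨η, hη, hball⟩ := Metric.eventually_nhds_iff.1 hpos
  obtain ⟨r, hr, hrη, ρ, hρ, -, hstab⟩ := exists_superJet_near isClosed_univ hp (half_pos hη)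
  obtain ⟨v, hv, hvx⟩ := exists_lt_of_lt_perronSup hne (show V i x - ρ < V i x by linarith)
  obtain ⟨y, q, hq, hy, hqp, hvy⟩ := hstab (v i) (hv.1 i).continuousOn
    (fun y _ => by linarith [le_perronSup hlam hv i y]) hvx.le
  have h1 := @hball ((y, q), η / 2) (by
    rw [Prod.dist_eq, Prod.dist_eq, dist_eq_norm q p, Real.dist_eq, sub_zero,
      abs_of_pos (half_pos hη)]
    exact max_lt (max_lt (by simp only; linarith) (by linarith)) (by linarith))
  have h2 := hv.2.2 i y q hq
  have h3 := le_perronSup hlam hv (!i) y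
  simp only at h1
  nlinarith

/-- If the inequality failed at `x`, lifting a test function slightly above component `i` near `x`
would give a member of the family exceeding the supremum. -/
theorem isSystemSuper_perronSup (hG : ∀ i, Continuous (Function.uncurry (G i))) (hlam : 0 < lam)
    (hC : ∀ i x, |G i x 0| ≤ C) (hne : (perronFamily G lam C).Nonempty)
    (hcont : ∀ i, Continuous (perronSup G lam C i)) :
    IsSystemSuper G lam 0 (perronSup G lam C) := by
  intro i x p hp
  have hsub := isSystemSub_perronSup hG hlam hne hcont
  have hbd := abs_mul_perronSup_le (G := G) (C := C) hlam hne
  have hmax : ∀ w ∈ perronFamily G lam C, ∀ i x, w i x ≤ perronSup G lam C i x := fun w hw =>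
    le_perronSup hlam hw
  generalize hV : perronSup G lam C = V at *
  by_contra! hcon
  have hupper : ∀ y, V i y ≤ C / lam := fun y => by
    rw [le_div_iff₀ hlam, mul_comm]; exact (abs_le.1 (hbd i y)).2
  have hlower : ∀ j y, -(C / lam) ≤ V j y := fun j y => by
    rw [← neg_div, div_le_iff₀ hlam, mul_comm]; exact (abs_le.1 (hbd j y)).1
  -- Lifting must respect the cap `C / lam`. If the cap were attained at `x`, then `x` would be a
  -- maximum, so `p = 0`, and `G i x 0 ≥ -C` would give the supersolution inequality.
  have hlt : V i x < C / lam := by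
    refine lt_of_le_of_ne (hupper x) fun he => ?_
    have h0 := superJet_subJet_unique
      (mem_superJet_of_forall_le fun y => (hupper y).trans he.ge) hp
    subst h0
    have h1 : lam * V i x = C := by rw [he, mul_div_cancel₀ _ hlam.ne']
    have h2 := (abs_le.1 (hC i x)).1
    have h3 : V (!i) x ≤ C / lam := by
      rw [le_div_iff₀ hlam, mul_comm]; exact (abs_le.1 (hbd (!i) x)).2
    linarith
  obtain ⟨-, φ, hφ, ⟨r₀, hr₀, hmin⟩, rfl⟩ := mem_subJet_iff.1 hp
  -- the bump, normalized so that it touches `V i` at `x` when `d = 0`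
  have hψc : ContDiff ℝ 1 fun y => φ y - 1 * ‖y - x‖ ^ 2 :=
    hφ.sub (contDiff_const_mul_norm_sub_sq 1 x)
  set ψ : Eucl n → ℝ := fun y => φ y - 1 * ‖y - x‖ ^ 2 with hψ
  have hgψ : gradient ψ x = gradient φ x := by
    rw [hψ, gradient_fun_sub hφ (contDiff_const_mul_norm_sub_sq 1 x),
      gradient_const_mul_norm_sub_sq, sub_self, smul_zero, sub_zero]
  have hψx : ψ x = φ x := by simp [hψ]
  set b : ℝ := V i x - φ x with hb
  have hΨ : Continuous fun z : Eucl n × ℝ =>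
      (lam + 1) * (ψ z.1 + b + z.2) + G i z.1 (gradient ψ z.1) - V (!i) z.1 := by
    have h1 : Continuous fun z : Eucl n × ℝ => (lam + 1) * (ψ z.1 + b + z.2) :=
      continuous_const.mul (((hψc.continuous.comp continuous_fst).add continuous_const).add
        continuous_snd)
    exact (h1.add ((hG i).comp (continuous_fst.prodMk
      ((continuous_gradient hψc).comp continuous_fst)))).sub ((hcont !i).comp continuous_fst)
  have e1 : ∀ᶠ z : Eucl n × ℝ in 𝓝 (x, 0),
      (lam + 1) * (ψ z.1 + b + z.2) + G i z.1 (gradient ψ z.1) - V (!i) z.1 < 0 :=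
    (hΨ.tendsto _).eventually_lt (continuous_const.tendsto _) (by
      simp only [hgψ, hψx, hb]; linarith)
  have e2 : ∀ᶠ z : Eucl n × ℝ in 𝓝 (x, 0), ψ z.1 + b + z.2 < C / lam := by
    have h1 : Continuous fun z : Eucl n × ℝ => ψ z.1 + b + z.2 :=
      ((hψc.continuous.comp continuous_fst).add continuous_const).add continuous_snd
    exact (h1.tendsto _).eventually_lt (continuous_const.tendsto _) (by
      simp only [hψx, hb]; linarith)
  obtain ⟨η, hη, hball⟩ := Metric.eventually_nhds_iff.1 (e1.and e2)
  set r := min (η / 2) (r₀ / 2) with hr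
  have hrpos : 0 < r := by positivity
  have hrη : r ≤ η / 2 := min_le_left _ _
  have hr0 : r ≤ r₀ / 2 := min_le_right _ _
  -- The lift is below the drop `(r/2)²` of the bump, so the bump lies under `V i` on the outer
  -- annulus and the glued function is continuous.
  set d := min (η / 2) (r ^ 2 / 8) with hd
  have hdpos : 0 < d := by positivity
  have hdη : d ≤ η / 2 := min_le_left _ _
  have hdr : d ≤ r ^ 2 / 8 := min_le_right _ _
  have hnear : ∀ y, dist y x < r →
      (lam + 1) * (ψ y + b + d) + G i y (gradient ψ y) - V (!i) y < 0 ∧ ψ y + b + d < C / lam := by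
    intro y hy
    refine @hball (y, d) ?_
    rw [Prod.dist_eq, Real.dist_eq, sub_zero, abs_of_pos hdpos]
    exact max_lt (by simp only; linarith) (by linarith)
  have hfar : ∀ y, dist y x < r → r / 2 ≤ dist y x → ψ y + b + d < V i y := by
    intro y hy hy'
    have h1 := hmin y (mem_univ _) (by linarith)
    have h2 : (r / 2) ^ 2 ≤ dist y x ^ 2 := by gcongr
    rw [dist_eq_norm] at h2
    have h3 : 0 < r ^ 2 := by positivity
    simp only [hψ, hb]
    linarith
  classical
  set wi : Eucl n → ℝ := fun y => if dist y x < r then max (V i y) (ψ y + b + d) else V i y with hwi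
  have hwball : ∀ y, dist y x < r → wi y = max (V i y) (ψ y + b + d) := fun y hy => by
    simp only [hwi, if_pos hy]
  have hwout : ∀ y, r / 2 < dist y x → wi y = V i y := fun y hy => by
    by_cases h : dist y x < r
    · rw [hwball y h, max_eq_left (hfar y h hy.le).le]
    · simp only [hwi, if_neg h]
  have hVw : ∀ y, V i y ≤ wi y := fun y => by
    by_cases h : dist y x < r
    · rw [hwball y h]; exact le_max_left _ _
    · simp only [hwi, if_neg h]; exact le_rfl
  have hψcont : Continuous fun y => ψ y + b + d :=
    (hψc.continuous.add continuous_const).add continuous_const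
  have hwcont : Continuous wi := by
    rw [continuous_iff_continuousAt]
    intro y
    by_cases h : dist y x < r
    · have : ∀ᶠ z in 𝓝 y, dist z x < r :=
        (continuous_id.dist continuous_const).continuousAt.eventually_lt continuousAt_const h
      refine ContinuousAt.congr (((hcont i).max hψcont).continuousAt) ?_
      filter_upwards [this] with z hz using (hwball z hz).symm
    · have : ∀ᶠ z in 𝓝 y, r / 2 < dist z x :=
        continuousAt_const.eventually_lt (continuous_id.dist continuous_const).continuousAt
          (show r / 2 < dist y x by linarith [not_lt.1 h])
      refine ContinuousAt.congr ((hcont i).continuousAt) ?_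
      filter_upwards [this] with z hz using (hwout z hz).symm
  have hwle : ∀ y, wi y ≤ C / lam := fun y => by
    by_cases h : dist y x < r
    · rw [hwball y h]; exact max_le (hupper y) (hnear y h).2.le
    · simp only [hwi, if_neg h]; exact hupper y
  set w : Bool → Eucl n → ℝ := Function.update V i wi with hw
  have hwI : w i = wi := Function.update_self i wi V
  have hwJ : ∀ j, j ≠ i → w j = V j := fun j hj => Function.update_of_ne hj wi V
  have hni : (!i) ≠ i := by cases i <;> simp
  have hwmem : w ∈ perronFamily G lam C := by
    refine ⟨fun j => ?_, fun j y => ?_, fun j y q hq => ?_⟩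
    · rcases eq_or_ne j i with rfl | hj
      · rwa [hwI]
      · rw [hwJ j hj]; exact hcont j
    · rcases eq_or_ne j i with rfl | hj
      · rw [hwI, abs_le]
        have h1 := mul_le_mul_of_nonneg_left (hwle y) hlam.le
        have h2 := mul_le_mul_of_nonneg_left ((hlower j y).trans (hVw y)) hlam.le
        have h3 : lam * (C / lam) = C := mul_div_cancel₀ _ hlam.ne'
        constructor <;> linarith
      · rw [hwJ j hj]; exact hbd j y
    · rcases eq_or_ne j i with rfl | hj
      · rw [hwI] at hq ⊢
        rw [hwJ _ hni]
        by_cases hcase : wi y = V j y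
        · have := hsub j y q (superJet_congr_at (fun z _ => hVw z) hcase.symm hq)
          rwa [hcase]
        · have hyr : dist y x < r := by
            by_contra h
            exact hcase (by simp only [hwi, if_neg h])
          have hwψ : wi y = ψ y + b + d := by
            rw [hwball y hyr] at hcase ⊢
            exact max_eq_right (le_of_not_ge fun h => hcase (max_eq_left h))
          -- Where the bump is active it touches `wi` from below, so its gradient is the only
          -- possible superdifferential.
          have hq' : q = gradient ψ y := by
            refine superJet_subJet_unique hq (mem_subJet_iff.2 ⟨mem_univ _, ψ, hψc,
              ⟨r - dist y x, by linarith, fun z _ hz => ?_⟩, rfl⟩)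
            have : ψ z + b + d ≤ wi z := by
              rw [hwball z (by linarith [dist_triangle z y x])]; exact le_max_right _ _
            linarith
          rw [hq', hwψ]
          linarith [(hnear y hyr).1]
      -- The unmodified component remains a subsolution because its coupling term decreases as
      -- component `i` increases.
      · have hji : (!j) = i := by revert hj; cases i <;> cases j <;> simp
        rw [hwJ j hj] at hq ⊢
        rw [hji, hwI]
        have := hsub j y q hq
        rw [hji] at this
        linarith [hVw y]
  have hfin := hmax w hwmem i x
  rw [hwI, hwball x (by simpa using hrpos)] at hfin
  have := (le_max_right _ _).trans hfin
  rw [hψx, hb] at this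
  linarith

/-- Solvability of the discounted system, with bounds that do not depend on the discount. -/
theorem exists_discounted_solution (hG : ∀ i, IsPeriodicCoercive (G i)) :
    ∃ C L K : ℝ, 0 ≤ L ∧ ∀ lam : ℝ, 0 < lam → ∃ v : Bool → Eucl n → ℝ, (∀ i, IsZPeriodic (v i)) ∧
      (∀ i x, |lam * v i x| ≤ C) ∧ (∀ i x y, v i x ≤ v i y + L * ‖x - y‖) ∧
      (∀ i x, v i x - v (!i) x ≤ K) ∧ IsSystemSub G lam 0 v ∧ IsSystemSuper G lam 0 v := by
  obtain ⟨C, hC0, hC⟩ := exists_common_bound (p := fun i M => ∀ x, |G i x 0| ≤ M)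
    (fun b M M' h h' x => (h' x).trans h)
    (fun i => ((hG i).exists_abs_le 0).imp fun M hM x => hM x 0 (by simp))
  obtain ⟨m, hm0, hm⟩ := exists_common_bound (p := fun i M => ∀ x p, -M ≤ G i x p)
    (fun b M M' h h' x p => by linarith [h' x p]) (fun i => (hG i).exists_forall_ge)
  -- The threshold `2 * C + m` is the bound of `hamiltonian_le` with `c = 0`.
  obtain ⟨L, hL0, hL⟩ := exists_common_bound
    (p := fun i M => ∀ x p, G i x p ≤ 2 * C + m → ‖p‖ ≤ M)
    (fun b M M' h h' x p hp => (h' x p hp).trans h)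
    (fun i => ((hG i).exists_norm_le (2 * C + m)).imp fun M hM => hM.2)
  refine ⟨C, L, C + m, hL0, fun lam hlam => ?_⟩
  have hne : (perronFamily G lam C).Nonempty := ⟨_, const_mem_perronFamily hlam hC0 hC⟩
  -- A common Lipschitz constant for the family passes to the supremum and provides the continuity
  -- required by Perron's method.
  have hmemlip : ∀ v ∈ perronFamily G lam C, ∀ i x y, v i x ≤ v i y + L * ‖x - y‖ := by
    intro v hv i
    refine lipschitz_of_superJet_bound (hv.1 i) hL0 fun x p hp => hL i x p ?_
    have := hv.2.2.hamiltonian_le hv.1 hm (fun i x => (abs_le.1 (hv.2.1 i x)).1) hp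
    linarith
  have hlip : ∀ i x y, perronSup G lam C i x ≤ perronSup G lam C i y + L * ‖x - y‖ := by
    intro i x y
    refine perronSup_le hne fun v hv => ?_
    linarith [hmemlip v hv i x y, le_perronSup hlam hv i y]
  have hcont : ∀ i, Continuous (perronSup G lam C i) := fun i =>
    continuous_of_le_add_mul_norm hL0 (hlip i)
  have hbd := abs_mul_perronSup_le (G := G) (C := C) hlam hne
  have hsub := isSystemSub_perronSup (fun i => (hG i).cont) hlam hne hcont
  refine ⟨perronSup G lam C, perronSup_periodic (fun i => (hG i).periodic) hlam hne, hbd, hlip,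
    fun i x => ?_, hsub, isSystemSuper_perronSup (fun i => (hG i).cont) hlam hC hne hcont⟩
  have := hsub.sub_le hcont hm (fun i x => (abs_le.1 (hbd i x)).1) i x
  linarith

end Perron

/-! ### The cell problem and comparison of its constants. -/

section Cell

variable {n : ℕ} {G G' : Bool → Eucl n → Eucl n → ℝ} {c c' : ℝ} {v w : Bool → Eucl n → ℝ}

theorem superJet_sub_const {f : Eucl n → ℝ} {K : Set (Eucl n)} {x p : Eucl n} {a : ℝ}
    (h : (x, p) ∈ superJet K fun y => f y - a) : (x, p) ∈ superJet K f := by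
  rw [mem_superJet_iff] at h ⊢
  obtain ⟨hx, φ, hφ, ⟨r, hr, h⟩, hg⟩ := h
  exact ⟨hx, φ, hφ, ⟨r, hr, fun y hy hd => by linarith [h y hy hd]⟩, hg⟩

theorem subJet_sub_const {f : Eucl n → ℝ} {K : Set (Eucl n)} {x p : Eucl n} {a : ℝ}
    (h : (x, p) ∈ subJet K fun y => f y - a) : (x, p) ∈ subJet K f := by
  rw [mem_subJet_iff] at h ⊢
  obtain ⟨hx, φ, hφ, ⟨r, hr, h⟩, hg⟩ := h
  exact ⟨hx, φ, hφ, ⟨r, hr, fun y hy hd => by linarith [h y hy hd]⟩, hg⟩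

/-- Solvability of the cell problem for some constant. -/
theorem exists_cell_solution (hG : ∀ i, IsPeriodicCoercive (G i)) :
    ∃ (c : ℝ) (v : Bool → Eucl n → ℝ), (∀ i, Continuous (v i)) ∧ (∀ i, IsZPeriodic (v i)) ∧
      IsSystemSub G 0 c v ∧ IsSystemSuper G 0 c v := by
  obtain ⟨C, L, K, hL, hex⟩ := exists_discounted_solution hG
  choose! V hper hbd hlip hK hsub hsuper using hex
  set 𝓤 : Ultrafilter ℝ := Ultrafilter.of (𝓝[>] (0 : ℝ))
  have hU : (𝓤 : Filter ℝ) ≤ 𝓝[>] 0 := Ultrafilter.of_le _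
  have hpos : ∀ᶠ lam in (𝓤 : Filter ℝ), 0 < lam := hU self_mem_nhdsWithin
  have hlam : Tendsto (fun lam : ℝ => lam) 𝓤 (𝓝 0) := hU.trans nhdsWithin_le_nhds
  -- The same constant is subtracted from both components, so the coupling is unchanged and only
  -- `lam * V lam true 0` moves to the right side; its negative converges to the cell constant.
  set W : ℝ → Bool → Eucl n → ℝ := fun lam i x => V lam i x - V lam true 0 with hW
  set cs : ℝ → ℝ := fun lam => -(lam * V lam true 0) with hcs
  have hWlip : ∀ lam, 0 < lam → ∀ i x y, |W lam i x - W lam i y| ≤ L * ‖x - y‖ := by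
    intro lam hl i x y
    have h1 := hlip lam hl i x y
    have h2 := hlip lam hl i y x
    rw [norm_sub_rev] at h2
    rw [abs_le]
    constructor <;> simp only [hW] <;> linarith
  obtain ⟨c, -, hc⟩ := (isCompact_Icc (a := -C) (b := C)).ultrafilter_le_nhds (𝓤.map cs) (by
    rw [le_principal_iff]
    change cs ⁻¹' Icc (-C) C ∈ (𝓤 : Filter ℝ)
    filter_upwards [hpos] with lam hl
    have := abs_le.1 (hbd lam hl true 0)
    constructor <;> simp only [hcs] <;> linarith)
  have hc' : Tendsto cs 𝓤 (𝓝 c) := hc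
  have hlim : ∀ i, ∃ f, TendstoLocallyUniformlyOn (fun lam => W lam i) f (𝓤 : Filter ℝ) univ := by
    intro i
    refine exists_tendstoLocallyUniformlyOn_ultrafilter 𝓤 (fun x _ => ⟨L * ‖x‖ + K, ?_⟩)
      fun x _ η hη => ⟨η / (L + 1), by positivity, ?_⟩
    · filter_upwards [hpos] with lam hl
      have h1 := hWlip lam hl true x 0
      rw [sub_zero, abs_le] at h1
      have h2 := hK lam hl true x
      have h3 := hK lam hl false x
      simp only [Bool.not_true, Bool.not_false] at h2 h3
      simp only [hW, sub_self] at h1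
      rw [abs_le]
      cases i <;> constructor <;> simp only [hW] <;> linarith
    · filter_upwards [hpos] with lam hl y _ hd
      refine (hWlip lam hl i y x).trans ?_
      rw [dist_eq_norm, lt_div_iff₀ (by linarith)] at hd
      nlinarith [norm_nonneg (y - x)]
  choose v hv using hlim
  have hpt : ∀ i x, Tendsto (fun lam => W lam i x) 𝓤 (𝓝 (v i x)) := fun i x =>
    (hv i).tendsto_at (mem_univ x)
  have hvc : ∀ i, Continuous (v i) := by
    refine fun i => continuous_of_le_add_mul_norm hL fun x y => ?_
    refine le_of_tendsto_of_tendsto (hpt i x) ((hpt i y).add_const _) ?_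
    filter_upwards [hpos] with lam hl
    linarith [(abs_le.1 (hWlip lam hl i x y)).2]
  have hunif : ∀ i x, TendstoUniformlyOn (fun lam => W lam i) (v i) 𝓤 (Metric.closedBall x 1) :=
    fun i x => (tendstoLocallyUniformlyOn_iff_tendstoUniformlyOn_of_compact
      (isCompact_closedBall x 1)).1 ((hv i).mono (subset_univ _))
  have hWcont : ∀ᶠ lam in (𝓤 : Filter ℝ), ∀ i, Continuous (W lam i) := by
    filter_upwards [hpos] with lam hl i
    exact continuous_of_le_add_mul_norm hL fun x y => by
      linarith [(abs_le.1 (hWlip lam hl i x y)).2]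
  refine ⟨c, v, hvc, fun i x z => ?_, ?_, ?_⟩
  · refine tendsto_nhds_unique (hpt i _) ((hpt i x).congr' ?_)
    filter_upwards [hpos] with lam hl
    simp only [hW, hper lam hl i x z]
  · refine IsSystemSub.of_tendsto (fun i => (hG i).cont) hlam hc' hvc hunif hWcont ?_
    filter_upwards [hpos] with lam hl i x p hp
    have := hsub lam hl i x p (superJet_sub_const hp)
    simp only [hW, hcs]
    linarith
  · rw [isSystemSuper_iff_neg]
    refine IsSystemSub.of_tendsto (l := (𝓤 : Filter ℝ)) (lams := fun lam => lam)
      (cs := fun lam => -cs lam) (vs := fun lam i x => -W lam i x)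
      (fun i => ((hG i).cont.comp (continuous_fst.prodMk continuous_snd.neg)).neg) hlam hc'.neg
      (fun i => (hvc i).neg) (fun i x => ?_) ?_ ?_
    · rw [Metric.tendstoUniformlyOn_iff]
      intro η hη
      filter_upwards [Metric.tendstoUniformlyOn_iff.1 (hunif i x) η hη] with lam h y hy
      rw [dist_neg_neg]
      exact h y hy
    · filter_upwards [hWcont] with lam h i using (h i).neg
    · filter_upwards [hpos] with lam hl
      rw [← isSystemSuper_iff_neg]
      intro i x p hp
      have := hsuper lam hl i x p (subJet_sub_const hp)
      simp only [hW, hcs]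
      linarith

/-- Maximizing over components as well as points gives `w i - w (!i) ≤ v i - v (!i)` at the maximum,
the sign needed to discard the coupling. -/
theorem exists_forall_sub_le (hv : ∀ i, Continuous (v i)) (hw : ∀ i, Continuous (w i))
    (hpv : ∀ i, IsZPeriodic (v i)) (hpw : ∀ i, IsZPeriodic (w i)) :
    ∃ i x, ∀ j y, v j y - w j y ≤ v i x - w i x := by
  have h : ∀ i, ∃ x, ∀ y, v i y - w i y ≤ v i x - w i x := fun i =>
    IsZPeriodic.exists_forall_le ((hv i).sub (hw i))
      (fun y z => by simp only [hpv i y z, hpw i y z])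
  choose x hx using h
  rcases le_total (v true (x true) - w true (x true)) (v false (x false) - w false (x false)) with h | h
  · exact ⟨false, x false, fun j y => by cases j; exacts [hx _ y, (hx _ y).trans h]⟩
  · exact ⟨true, x true, fun j y => by cases j; exacts [(hx _ y).trans h, hx _ y]⟩

/-- Comparison of the constants of two cell problems. -/
theorem cell_compare (hG : ∀ i, Continuous (Function.uncurry (G i)))
    (hG' : ∀ i, Continuous (Function.uncurry (G' i)))
    (hv : ∀ i, Continuous (v i)) (hw : ∀ i, Continuous (w i))
    (hpv : ∀ i, IsZPeriodic (v i)) (hpw : ∀ i, IsZPeriodic (w i))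
    (hsub : IsSystemSub G 0 c v) (hsuper : IsSystemSuper G' 0 c' w) {R : ℝ}
    (hR : ∀ i x p, (x, p) ∈ superJet univ (v i) → ‖p‖ ≤ R) :
    ∃ i x p, ‖p‖ ≤ R ∧ c' - c ≤ G' i x p - G i x p := by
  obtain ⟨i, x, hx⟩ := exists_forall_sub_le hv hw hpv hpw
  obtain ⟨p, hp, h1, h2⟩ := exists_mem_closure_superJet_subJet (f := v i) (g := w i)
    (φ := fun _ => 0) isClosed_univ (mem_univ x) one_pos (hv i).continuousOn (hw i).continuousOn
    contDiff_const (fun y _ => by simpa using hx i y) (fun x p h _ => hR i x p h)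
  rw [gradient_fun_const, sub_zero] at h2
  have h3 : 0 * v i x + G i x p + v i x - v (!i) x ≤ c := by
    have hcl : IsClosed {z : Eucl n × Eucl n |
        0 * v i z.1 + G i z.1 z.2 + v i z.1 - v (!i) z.1 ≤ c} :=
      isClosed_le ((((continuous_const.mul ((hv i).comp continuous_fst)).add (hG i)).add
        ((hv i).comp continuous_fst)).sub ((hv !i).comp continuous_fst)) continuous_const
    exact closure_minimal (fun z hz => hsub i z.1 z.2 hz) hcl h1
  have h4 : c' ≤ 0 * w i x + G' i x p + w i x - w (!i) x := by
    have hcl : IsClosed {z : Eucl n × Eucl n |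
        c' ≤ 0 * w i z.1 + G' i z.1 z.2 + w i z.1 - w (!i) z.1} :=
      isClosed_le continuous_const ((((continuous_const.mul ((hw i).comp continuous_fst)).add
        (hG' i)).add ((hw i).comp continuous_fst)).sub ((hw !i).comp continuous_fst))
    exact closure_minimal (fun z hz => hsuper i z.1 z.2 hz) hcl h2
  exact ⟨i, x, p, hp, by linarith [hx (!i) x]⟩

/-- At the joint minimum of `w` the zero gradient is admissible and the coupling is nonpositive.
This bounds the cell constant from above. -/
theorem IsSystemSuper.exists_le (hw : ∀ i, Continuous (w i)) (hpw : ∀ i, IsZPeriodic (w i))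
    (hsuper : IsSystemSuper G 0 c w) : ∃ i x, c ≤ G i x 0 := by
  obtain ⟨i, x, hx⟩ := exists_forall_sub_le (v := fun _ _ => 0) (fun _ => continuous_const) hw
    (fun _ _ _ => rfl) hpw
  have h1 := hsuper i x 0 (mem_subJet_of_forall_ge fun y => by linarith [hx i y])
  exact ⟨i, x, by linarith [hx (!i) x]⟩

/-- The superdifferentials of solutions of the cell problem are bounded, with a bound that depends
only on an upper bound for the constant. -/
theorem exists_superJet_bound (hG : ∀ i, IsPeriodicCoercive (G i)) (C : ℝ) :
    ∃ R, ∀ (P : Eucl n) (c : ℝ) (v : Bool → Eucl n → ℝ), c ≤ C → (∀ i, Continuous (v i)) →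
      IsSystemSub (fun i x p => G i x (P + p)) 0 c v →
      ∀ i x p, (x, p) ∈ superJet univ (v i) → ‖p‖ ≤ R + ‖P‖ := by
  obtain ⟨m, hm0, hm⟩ := exists_common_bound (p := fun i M => ∀ x p, -M ≤ G i x p)
    (fun b M M' h h' x p => by linarith [h' x p]) (fun i => (hG i).exists_forall_ge)
  obtain ⟨R, hR0, hR⟩ := exists_common_bound
    (p := fun i M => ∀ x p, G i x p ≤ 2 * C + m → ‖p‖ ≤ M)
    (fun b M M' h h' x p hp => (h' x p hp).trans h)
    (fun i => ((hG i).exists_norm_le (2 * C + m)).imp fun M hM => hM.2)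
  refine ⟨R, fun P c v hc hv hsub i x p hp => ?_⟩
  have h1 := hsub.hamiltonian_le hv (m := m) (C := 0) (fun i x p => hm i x _) (by simp) hp
  have h2 := hR i x (P + p) (by linarith)
  have : ‖p‖ ≤ ‖P + p‖ + ‖P‖ := by simpa using norm_sub_le (P + p) P
  linarith

end Cell

/-! ### Existence, uniqueness and continuity of the effective Hamiltonian. -/

section Effective

variable {n : ℕ} {H : Bool → Eucl n → Eucl n → ℝ}

theorem isViscositySubsolution_univ_iff {F : Eucl n → ℝ → Eucl n → ℝ} {u : Eucl n → ℝ} :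
    IsViscositySubsolution univ F u ↔ ∀ x p, (x, p) ∈ superJet univ u → F x (u x) p ≤ 0 := by
  constructor
  · rintro h x p ⟨-, φ, hφ, hmax, hg⟩
    obtain rfl : gradient φ x = p := hg
    exact h x (mem_univ x) φ hφ (isLocalMaxOn_univ_iff.1 hmax)
  · exact fun h x _ φ hφ hmax => h x _ ⟨mem_univ x, φ, hφ, isLocalMaxOn_univ_iff.2 hmax, rfl⟩

theorem isViscositySupersolution_univ_iff {F : Eucl n → ℝ → Eucl n → ℝ} {u : Eucl n → ℝ} :
    IsViscositySupersolution univ F u ↔ ∀ x p, (x, p) ∈ subJet univ u → 0 ≤ F x (u x) p := by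
  constructor
  · rintro h x p ⟨-, φ, hφ, hmin, hg⟩
    obtain rfl : gradient φ x = p := hg
    exact h x (mem_univ x) φ hφ (isLocalMinOn_univ_iff.1 hmin)
  · exact fun h x _ φ hφ hmin => h x _ ⟨mem_univ x, φ, hφ, isLocalMinOn_univ_iff.2 hmin, rfl⟩

theorem isCellConstant_iff {H : Bool → Eucl n → Eucl n → ℝ} {P : Eucl n} {c : ℝ} :
    IsCellConstant (H true) (H false) P c ↔ ∃ v : Bool → Eucl n → ℝ, (∀ i, Continuous (v i)) ∧
      (∀ i, IsZPeriodic (v i)) ∧ IsSystemSub (fun i x p => H i x (P + p)) 0 c v ∧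
      IsSystemSuper (fun i x p => H i x (P + p)) 0 c v := by
  constructor
  · rintro ⟨v₁, v₂, hc1, hc2, hp1, hp2, ⟨h1, h1'⟩, h2, h2'⟩
    rw [isViscositySubsolution_univ_iff] at h1 h2
    rw [isViscositySupersolution_univ_iff] at h1' h2'
    refine ⟨fun i => cond i v₁ v₂, fun i => by cases i <;> assumption,
      fun i => by cases i <;> assumption, fun i x p hp => ?_, fun i x p hp => ?_⟩
    · cases i
      · have := h2 x p hp
        simp only [Bool.not_false, cond_false, cond_true]
        linarith
      · have := h1 x p hp
        simp only [Bool.not_true, cond_false, cond_true]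
        linarith
    · cases i
      · have := h2' x p hp
        simp only [Bool.not_false, cond_false, cond_true]
        linarith
      · have := h1' x p hp
        simp only [Bool.not_true, cond_false, cond_true]
        linarith
  · rintro ⟨v, hc, hp, hsub, hsuper⟩
    refine ⟨v true, v false, hc _, hc _, hp _, hp _, ⟨?_, ?_⟩, ?_, ?_⟩
    · refine isViscositySubsolution_univ_iff.2 fun x p hx => ?_
      have := hsub true x p hx
      simp only [Bool.not_true] at this
      linarith
    · refine isViscositySupersolution_univ_iff.2 fun x p hx => ?_
      have := hsuper true x p hx
      simp only [Bool.not_true] at this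
      linarith
    · refine isViscositySubsolution_univ_iff.2 fun x p hx => ?_
      have := hsub false x p hx
      simp only [Bool.not_false] at this
      linarith
    · refine isViscositySupersolution_univ_iff.2 fun x p hx => ?_
      have := hsuper false x p hx
      simp only [Bool.not_false] at this
      linarith

/-- Existence and uniqueness of the effective Hamiltonian. -/
theorem exists_isEffectiveHamiltonian (hH : ∀ i, IsPeriodicCoercive (H i)) :
    ∃ Hbar, IsEffectiveHamiltonian (H true) (H false) Hbar := by
  have hex : ∀ P : Eucl n, ∃ c, IsCellConstant (H true) (H false) P c := fun P => by
    obtain ⟨c, v, h⟩ := exists_cell_solution fun i => (hH i).shift P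
    exact ⟨c, isCellConstant_iff.2 ⟨v, h⟩⟩
  have huniq : ∀ (P : Eucl n) (c c' : ℝ), IsCellConstant (H true) (H false) P c →
      IsCellConstant (H true) (H false) P c' → c' ≤ c := by
    intro P c c' h h'
    obtain ⟨v, hv, hpv, hsub, -⟩ := isCellConstant_iff.1 h
    obtain ⟨w, hw, hpw, -, hsuper⟩ := isCellConstant_iff.1 h'
    obtain ⟨R, hR⟩ := exists_superJet_bound hH c
    obtain ⟨i, x, p, -, hle⟩ := cell_compare (fun i => ((hH i).shift P).cont)
      (fun i => ((hH i).shift P).cont) hv hw hpv hpw hsub hsuper (hR P c v le_rfl hv hsub)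
    linarith
  choose Hbar hHbar using hex
  refine ⟨Hbar, fun P c => ⟨fun h => le_antisymm (huniq P _ _ (hHbar P) h) (huniq P _ _ h (hHbar P)),
    fun h => h ▸ hHbar P⟩⟩

/-- Comparing the cell problems at `P` and `Q` bounds `Hbar Q - Hbar P` by `H i x (Q + p) - H i x (P
+ p)` for some bounded `p`, so the modulus of continuity of the Hamiltonians carries over. -/
theorem IsEffectiveHamiltonian.continuous (hH : ∀ i, IsPeriodicCoercive (H i)) {Hbar : Eucl n → ℝ}
    (hbar : IsEffectiveHamiltonian (H true) (H false) Hbar) : Continuous Hbar := by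
  rw [continuous_iff_continuousAt]
  intro P₀
  obtain ⟨C, -, hC⟩ := exists_common_bound
    (p := fun i M => ∀ x p : Eucl n, ‖p‖ ≤ ‖P₀‖ + 1 → |H i x p| ≤ M)
    (fun b M M' h h' x p hp => (h' x p hp).trans h) (fun i => (hH i).exists_abs_le _)
  obtain ⟨R, hR⟩ := exists_superJet_bound hH C
  have hP1 : ∀ P : Eucl n, dist P P₀ < 1 → ‖P‖ ≤ ‖P₀‖ + 1 := fun P hP => by
    rw [dist_eq_norm] at hP
    have : ‖P‖ ≤ ‖P - P₀‖ + ‖P₀‖ := by simpa using norm_add_le (P - P₀) P₀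
    linarith
  rw [Metric.continuousAt_iff]
  intro θ hθ
  -- The radius bounds `P + p`, using `‖P‖ ≤ ‖P₀‖ + 1` and `‖p‖ ≤ R + ‖P‖`.
  have hmod : ∀ i, ∃ δ > 0, ∀ ξ p q : Eucl n, ‖p‖ ≤ R + 2 * (‖P₀‖ + 1) → ‖p - q‖ < δ →
      |H i ξ p - H i ξ q| < θ := fun i => (hH i).exists_modulus _ hθ
  choose δ hδ hmod using hmod
  set d := min 1 (min (δ true) (δ false)) with hd
  have hdpos : 0 < d := by have := hδ true; have := hδ false; positivity
  have hd1 : d ≤ 1 := min_le_left _ _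
  have hdi : ∀ i, d ≤ δ i := fun i => by
    cases i
    · exact (min_le_right _ _).trans (min_le_right _ _)
    · exact (min_le_right _ _).trans (min_le_left _ _)
  have key : ∀ P Q : Eucl n, dist P P₀ < 1 → ‖P - Q‖ < d → Hbar Q - Hbar P < θ := by
    intro P Q hP hPQ
    obtain ⟨v, hv, hpv, hsub, hsup⟩ := isCellConstant_iff.1 ((hbar P _).2 rfl)
    obtain ⟨w, hw, hpw, -, hsuper⟩ := isCellConstant_iff.1 ((hbar Q _).2 rfl)
    obtain ⟨j, y, hjy⟩ := hsup.exists_le hv hpv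
    have hle : Hbar P ≤ C :=
      hjy.trans ((abs_le.1 (hC j y _ (by rw [add_zero]; exact hP1 P hP))).2)
    obtain ⟨i, x, p, hp, hle⟩ := cell_compare (fun i => ((hH i).shift P).cont)
      (fun i => ((hH i).shift Q).cont) hv hw hpv hpw hsub hsuper (hR P _ v hle hv hsub)
    have hPp : ‖P + p‖ ≤ R + 2 * (‖P₀‖ + 1) := by linarith [norm_add_le P p, hP1 P hP]
    have := hmod i x (P + p) (Q + p) hPp (by
      rw [add_sub_add_right_eq_sub]; exact hPQ.trans_le (hdi i))
    rw [abs_lt] at this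
    linarith
  refine ⟨d, hdpos, fun P hP => ?_⟩
  rw [Real.dist_eq, abs_lt]
  have h1 := key P P₀ (hP.trans_le hd1) (by rwa [← dist_eq_norm])
  have h2 := key P₀ P (by simp) (by rwa [← dist_eq_norm, dist_comm])
  constructor <;> linarith

end Effective

/-! ### Local geometry of Lipschitz domains. -/

section Geometry

variable {n : ℕ} {Ω : Set (Eucl n)}

theorem norm_sub_inner_smul_le {ν : Eucl n} (hν : ‖ν‖ = 1) (v : Eucl n) :
    ‖v - inner ℝ ν v • ν‖ ≤ ‖v‖ := by
  refine le_of_sq_le_sq ?_ (norm_nonneg _)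
  rw [norm_sub_sq_real, inner_smul_right, norm_smul, hν, real_inner_comm, mul_one, Real.norm_eq_abs,
    sq_abs]
  nlinarith [sq_nonneg (inner ℝ ν v)]

/-- The part of a Lipschitz domain in a small ball around a boundary point, described by a strict
inequality that is monotone in the direction `ν`. -/
theorem HasLipschitzBoundary.exists_local_graph (hΩ : HasLipschitzBoundary Ω) {z : Eucl n}
    (hz : z ∈ frontier Ω) : ∃ (ν : Eucl n) (r K : ℝ) (a : Eucl n → ℝ), ‖ν‖ = 1 ∧ 0 < r ∧ 0 ≤ K ∧
      (∀ x ∈ Metric.ball z r, x ∈ Ω ↔ 0 < a x) ∧ (∀ x y, a x ≤ a y + (1 + K) * ‖x - y‖) ∧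
      ∀ x t, a (x + t • ν) = a x + t := by
  obtain ⟨ν, r, K, γ, hν, hr, hγ, hΩr⟩ := hΩ z hz
  -- The defining function is the signed height above the graph in the direction `ν`.
  refine ⟨ν, r, K, fun x => inner ℝ ν x - γ (x - inner ℝ ν x • ν), hν, hr, K.2, fun x hx => ?_,
    fun x y => ?_, fun x t => ?_⟩
  · have : x ∈ Ω ∩ Metric.ball z r ↔ x ∈ {x ∈ Metric.ball z r | γ (x - inner ℝ ν x • ν) < inner ℝ ν x} := by
      rw [hΩr]
    simp only [mem_inter_iff, hx, and_true, mem_ofPred_eq, true_and] at this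
    rw [this, sub_pos]
  · have h1 : inner ℝ ν x - inner ℝ ν y ≤ ‖x - y‖ := by
      rw [← inner_sub_right]
      simpa [hν] using real_inner_le_norm ν (x - y)
    have h2 := hγ.dist_le_mul (x - inner ℝ ν x • ν) (y - inner ℝ ν y • ν)
    have h3 : x - inner ℝ ν x • ν - (y - inner ℝ ν y • ν) =
        (x - y) - inner ℝ ν (x - y) • ν := by
      rw [inner_sub_right]; module
    rw [Real.dist_eq, dist_eq_norm, h3] at h2
    have h4 := mul_le_mul_of_nonneg_left (norm_sub_inner_smul_le hν (x - y)) K.2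
    have h5 := neg_abs_le (γ (x - inner ℝ ν x • ν) - γ (y - inner ℝ ν y • ν))
    simp only [NNReal.val_eq_coe] at h4 ⊢
    linarith
  · have h1 : inner ℝ ν (x + t • ν) = inner ℝ ν x + t := by
      rw [inner_add_right, inner_smul_right, real_inner_self_eq_norm_sq, hν]; ring
    have h2 : x + t • ν - (inner ℝ ν x + t) • ν = x - inner ℝ ν x • ν := by module
    simp only [h1, h2]
    ring

theorem mem_of_mem_closure_of_notMem_frontier (hΩ : IsOpen Ω) {x : Eucl n} (hx : x ∈ closure Ω)
    (h : x ∉ frontier Ω) : x ∈ Ω := by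
  rw [hΩ.frontier_eq] at h
  by_contra hcon
  exact h ⟨hx, hcon⟩

theorem notMem_frontier_of_mem (hΩ : IsOpen Ω) {x : Eucl n} (hx : x ∈ Ω) : x ∉ frontier Ω := by
  rw [hΩ.frontier_eq]
  exact fun h => h.2 hx

theorem continuous_of_le_add_mul {a : Eucl n → ℝ} {K : ℝ} (hK : 0 ≤ K)
    (h : ∀ x y, a x ≤ a y + (1 + K) * ‖x - y‖) : Continuous a :=
  continuous_of_le_add_mul_norm (by linarith) h

/-- On the closure the height above the graph is nonnegative, and moving by `t • ν` raises it by
`t`. Near an interior point `ν = 0` will do. -/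
theorem HasLipschitzBoundary.exists_inward (hΩ : HasLipschitzBoundary Ω) (hΩo : IsOpen Ω)
    {x₀ : Eucl n} (hx₀ : x₀ ∈ closure Ω) : ∃ (ν : Eucl n) (r : ℝ), 0 < r ∧
      ∀ y ∈ closure Ω, dist y x₀ < r → ∀ t : ℝ, 0 < t → t < r → y + t • ν ∈ Ω := by
  by_cases hf : x₀ ∈ frontier Ω
  · obtain ⟨ν, r, K, a, hν, hr, hK, hmem, hlip, hshift⟩ := hΩ.exists_local_graph hf
    have hac := continuous_of_le_add_mul hK hlip
    refine ⟨ν, r / 2, by positivity, fun y hy hd t ht htr => ?_⟩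
    have hay : 0 ≤ a y := by
      have hcl : y ∈ closure (Metric.ball x₀ r ∩ Ω) :=
        Metric.isOpen_ball.inter_closure ⟨show dist y x₀ < r by linarith, hy⟩
      exact closure_minimal (fun z hz => ((hmem z hz.1).1 hz.2).le)
        (isClosed_le continuous_const hac) hcl
    refine (hmem _ ?_).2 (by rw [hshift]; linarith)
    have : dist (y + t • ν) y = t := by
      rw [dist_eq_norm, add_sub_cancel_left, norm_smul, hν, mul_one, Real.norm_of_nonneg ht.le]
    exact lt_of_le_of_lt (dist_triangle _ y _) (by linarith)
  · obtain ⟨r, hr, hsub⟩ := Metric.isOpen_iff.1 hΩo x₀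
      (mem_of_mem_closure_of_notMem_frontier hΩo hx₀ hf)
    exact ⟨0, r, hr, fun y _ hd t _ _ => by simpa using hsub hd⟩

/-- Moving against `ν` makes the height negative. The exterior points found here serve as centres of
steep paraboloids. -/
theorem HasLipschitzBoundary.exists_notMem_closure (hΩ : HasLipschitzBoundary Ω) (hΩo : IsOpen Ω)
    {x₀ : Eucl n} (hx₀ : x₀ ∈ frontier Ω) {η : ℝ} (hη : 0 < η) :
    ∃ z, dist z x₀ < η ∧ z ∉ closure Ω := by
  obtain ⟨ν, r, K, a, hν, hr, hK, hmem, hlip, hshift⟩ := hΩ.exists_local_graph hx₀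
  have hac := continuous_of_le_add_mul hK hlip
  have ha0 : a x₀ ≤ 0 := not_lt.1 fun h =>
    notMem_frontier_of_mem hΩo ((hmem x₀ (Metric.mem_ball_self hr)).2 h) hx₀
  set s := min (η / 2) (r / 2)
  have hs : 0 < s := by positivity
  have hs1 : s ≤ η / 2 := min_le_left _ _
  have hs2 : s ≤ r / 2 := min_le_right _ _
  have hd : dist (x₀ + (-s) • ν) x₀ = s := by
    rw [dist_eq_norm, add_sub_cancel_left, norm_smul, hν, mul_one, norm_neg,
      Real.norm_of_nonneg hs.le]
  refine ⟨x₀ + (-s) • ν, by linarith, fun hcl => ?_⟩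
  have hcl' : x₀ + (-s) • ν ∈ closure (Metric.ball x₀ r ∩ Ω) :=
    Metric.isOpen_ball.inter_closure ⟨show dist _ x₀ < r by linarith, hcl⟩
  have : 0 ≤ a (x₀ + (-s) • ν) := closure_minimal (fun z hz => ((hmem z hz.1).1 hz.2).le)
    (isClosed_le continuous_const hac) hcl'
  rw [hshift] at this
  linarith

/-- Functions with bounded superdifferential are uniformly Lipschitz near every point of the closure
of a Lipschitz domain. -/
theorem HasLipschitzBoundary.exists_local_lipschitz (hΩ : HasLipschitzBoundary Ω) (hΩo : IsOpen Ω)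
    {x₀ : Eucl n} (hx₀ : x₀ ∈ closure Ω) : ∃ r > 0, ∃ A ≥ 0, ∀ L ≥ 0, ∀ u : Eucl n → ℝ,
      ContinuousOn u (closure Ω) → (∀ x p, (x, p) ∈ superJet Ω u → ‖p‖ ≤ L) →
      ∀ x ∈ closure Ω, ∀ y ∈ closure Ω, dist x x₀ < r → dist y x₀ < r →
        u x - u y ≤ A * L * ‖x - y‖ := by
  suffices h : ∃ r > 0, ∃ A ≥ 0, ∀ L ≥ 0, ∀ u : Eucl n → ℝ,
      ContinuousOn u (closure Ω) → (∀ x p, (x, p) ∈ superJet Ω u → ‖p‖ ≤ L) →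
      ∀ x ∈ Ω, ∀ y ∈ Ω, dist x x₀ < r → dist y x₀ < r → u x - u y ≤ A * L * ‖x - y‖ by
    obtain ⟨r, hr, A, hA, h⟩ := h
    refine ⟨r, hr, A, hA, fun L hL u hu hL' x hx y hy hxr hyr => ?_⟩
    have hcl : ∀ x ∈ closure Ω, dist x x₀ < r → x ∈ closure (Metric.ball x₀ r ∩ Ω) :=
      fun x hx hd => Metric.isOpen_ball.inter_closure ⟨hd, hx⟩
    have hmem : (x, y) ∈ closure ((Metric.ball x₀ r ∩ Ω) ×ˢ (Metric.ball x₀ r ∩ Ω)) := by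
      rw [closure_prod_eq]; exact ⟨hcl x hx hxr, hcl y hy hyr⟩
    have hsub : closure (Metric.ball x₀ r ∩ Ω) ⊆ closure Ω := closure_mono inter_subset_right
    refine le_on_closure (f := fun z : Eucl n × Eucl n => u z.1 - u z.2)
      (g := fun z => A * L * ‖z.1 - z.2‖)
      (fun z hz => h L hL u hu hL' z.1 hz.1.2 z.2 hz.2.2 hz.1.1 hz.2.1) ?_ (by fun_prop) hmem
    rw [closure_prod_eq]
    exact (hu.comp continuousOn_fst fun z hz => hsub hz.1).sub
      (hu.comp continuousOn_snd fun z hz => hsub hz.2)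
  by_cases hf : x₀ ∈ frontier Ω
  · obtain ⟨ν, ρ, K, a, hν, hρ, hK, hmem, hlip, hshift⟩ := hΩ.exists_local_graph hf
    -- Join `x` to `y` by going up by `t = (1 + K)‖x - y‖`, across, and down. The rise compensates
    -- any loss of height along the middle segment, the path has length `(2(1 + K) + 1)‖x - y‖`, and
    -- it stays in the chart because `r + (2 + 2K) r = ρ`.
    refine ⟨ρ / (3 + 2 * K), by positivity, 2 * (1 + K) + 1, by positivity,
      fun L hL u hu hL' x hx y hy hxr hyr => ?_⟩
    set r := ρ / (3 + 2 * K) with hr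
    have hrρ : (3 + 2 * K) * r = ρ := by rw [hr]; field_simp
    have hrpos : 0 < r := by positivity
    have hxy : ‖x - y‖ < 2 * r := by
      rw [← dist_eq_norm]; linarith [dist_triangle_right x y x₀]
    set t := (1 + K) * ‖x - y‖ with ht
    have ht0 : 0 ≤ t := by positivity
    have htr : t ≤ (2 + 2 * K) * r := by nlinarith
    have hball : ∀ w, dist w x₀ < r → ∀ s, 0 ≤ s → s ≤ t → w + s • ν ∈ Metric.ball x₀ ρ := by
      intro w hw s hs hst
      have : dist (w + s • ν) w = s := by
        rw [dist_eq_norm, add_sub_cancel_left, norm_smul, hν, mul_one, Real.norm_of_nonneg hs]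
      exact lt_of_le_of_lt (dist_triangle _ w _) (by linarith)
    have hvert : ∀ w ∈ Ω, dist w x₀ < r → ∀ s, 0 ≤ s → s ≤ t → w + s • ν ∈ Ω := by
      intro w hwΩ hw s hs hst
      refine (hmem _ (hball w hw s hs hst)).2 ?_
      rw [hshift]
      have := (hmem w (by simpa using hball w hw 0 le_rfl ht0)).1 hwΩ
      linarith
    have hseg1 : ∀ w ∈ Ω, dist w x₀ < r → segment ℝ w (w + t • ν) ⊆ Ω := by
      intro w hwΩ hw z hz
      rw [segment_eq_image'] at hz
      obtain ⟨θ, hθ, rfl⟩ := hz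
      have := hvert w hwΩ hw (θ * t) (mul_nonneg hθ.1 ht0) (mul_le_of_le_one_left ht0 hθ.2)
      simpa [smul_smul] using this
    have hseg2 : segment ℝ (y + t • ν) (x + t • ν) ⊆ Ω := by
      intro z hz
      rw [segment_eq_image'] at hz
      obtain ⟨θ, hθ, rfl⟩ := hz
      set w := y + θ • (x - y) with hw
      have e : y + t • ν + θ • (x + t • ν - (y + t • ν)) = w + t • ν := by rw [hw]; module
      beta_reduce
      rw [e]
      have hwr : dist w x₀ < r := by
        have := (convex_ball x₀ r).segment_subset (show y ∈ Metric.ball x₀ r from hyr)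
          (show x ∈ Metric.ball x₀ r from hxr)
        exact this (by rw [segment_eq_image']; exact ⟨θ, hθ, rfl⟩)
      refine (hmem _ (hball w hwr t ht0 le_rfl)).2 ?_
      rw [hshift]
      have h1 := (hmem y (by simpa using hball y hyr 0 le_rfl ht0)).1 hy
      have h2 := hlip y w
      have h3 : ‖y - w‖ ≤ ‖x - y‖ := by
        rw [hw, sub_add_cancel_left, norm_neg, norm_smul, Real.norm_of_nonneg hθ.1]
        exact mul_le_of_le_one_left (norm_nonneg _) hθ.2
      have h4 : (1 + K) * ‖y - w‖ ≤ t := by rw [ht]; gcongr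
      linarith
    have huΩ := hu.mono subset_closure
    have i1 := sub_le_of_superJet_bound hΩo huΩ hL hL' (segment_symm ℝ x (x + t • ν) ▸ hseg1 x hx hxr)
    have i2 := sub_le_of_superJet_bound hΩo huΩ hL hL' (hseg1 y hy hyr)
    have i3 := sub_le_of_superJet_bound hΩo huΩ hL hL' hseg2
    rw [norm_sub_rev] at i1
    rw [add_sub_cancel_left, norm_smul, hν, Real.norm_of_nonneg ht0] at i1 i2
    rw [add_sub_add_right_eq_sub] at i3
    rw [ht] at i1 i2
    linarith
  · obtain ⟨r, hr, hsub⟩ := Metric.isOpen_iff.1 hΩo x₀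
      (mem_of_mem_closure_of_notMem_frontier hΩo hx₀ hf)
    refine ⟨r, hr, 1, zero_le_one, fun L hL u hu hL' x _ y _ hxr hyr => ?_⟩
    rw [one_mul]
    exact sub_le_of_superJet_bound hΩo (hu.mono subset_closure) hL hL'
      (((convex_ball x₀ r).segment_subset hyr hxr).trans hsub)

end Geometry

/-! ### The Dirichlet problem: jet formulation and uniform estimates. -/

section Dirichlet

variable {n : ℕ} {Ω : Set (Eucl n)}

/-- Interior and boundary tests merge because extrema relative to the closure at interior points are
ordinary local extrema. -/
theorem isDirichletViscositySolution_iff (hΩ : IsOpen Ω) {F : Eucl n → ℝ → Eucl n → ℝ}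
    {g u : Eucl n → ℝ} : IsDirichletViscositySolution Ω F g u ↔ ContinuousOn u (closure Ω) ∧
      (∀ x p, (x, p) ∈ superJet (closure Ω) u →
        F x (u x) p ≤ 0 ∨ (x ∈ frontier Ω ∧ u x ≤ g x)) ∧
      (∀ x p, (x, p) ∈ subJet (closure Ω) u →
        0 ≤ F x (u x) p ∨ (x ∈ frontier Ω ∧ g x ≤ u x)) := by
  constructor
  · intro h
    refine ⟨h.continuousOn, ?_, ?_⟩
    · rintro x p ⟨hx, φ, hφ, hmax, hg⟩
      obtain rfl : gradient φ x = p := hg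
      by_cases hf : x ∈ frontier Ω
      · exact (h.boundary_sub x hf φ hφ hmax).imp_right fun h => ⟨hf, h⟩
      · have hxΩ := mem_of_mem_closure_of_notMem_frontier hΩ hx hf
        exact Or.inl (h.interior.1 x hxΩ φ hφ
          (hmax.isLocalMax (mem_of_superset (hΩ.mem_nhds hxΩ) subset_closure)))
    · rintro x p ⟨hx, φ, hφ, hmin, hg⟩
      obtain rfl : gradient φ x = p := hg
      by_cases hf : x ∈ frontier Ω
      · exact (h.boundary_super x hf φ hφ hmin).imp_right fun h => ⟨hf, h⟩
      · have hxΩ := mem_of_mem_closure_of_notMem_frontier hΩ hx hf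
        exact Or.inl (h.interior.2 x hxΩ φ hφ
          (hmin.isLocalMin (mem_of_superset (hΩ.mem_nhds hxΩ) subset_closure)))
  · rintro ⟨hc, hsub, hsuper⟩
    refine ⟨hc, ⟨fun x hx φ hφ hmax => ?_, fun x hx φ hφ hmin => ?_⟩, fun x hx φ hφ hmax => ?_,
      fun x hx φ hφ hmin => ?_⟩
    · exact (hsub x _ ⟨subset_closure hx, φ, hφ, hmax.on _, rfl⟩).resolve_right
        fun h => notMem_frontier_of_mem hΩ hx h.1
    · exact (hsuper x _ ⟨subset_closure hx, φ, hφ, hmin.on _, rfl⟩).resolve_right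
        fun h => notMem_frontier_of_mem hΩ hx h.1
    · exact (hsub x _ ⟨frontier_subset_closure hx, φ, hφ, hmax, rfl⟩).imp_right And.right
    · exact (hsuper x _ ⟨frontier_subset_closure hx, φ, hφ, hmin, rfl⟩).imp_right And.right

/-- A function with superdifferential bounded wherever the boundary inequality fails satisfies the
boundary inequality. -/
theorem le_of_superJet_bound_or {u g : Eucl n → ℝ} {L : ℝ} (hΩc : IsCompact (closure Ω))
    (hu : ContinuousOn u (closure Ω)) (hg : ContinuousOn g (frontier Ω))
    (h : ∀ x p, (x, p) ∈ superJet (closure Ω) u → ‖p‖ ≤ L ∨ (x ∈ frontier Ω ∧ u x ≤ g x))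
    {x₀ : Eucl n} (hx₀ : x₀ ∈ frontier Ω)
    (hext : ∀ η > 0, ∃ z, dist z x₀ < η ∧ z ∉ closure Ω) : u x₀ ≤ g x₀ := by
  by_contra! hcon
  have hev : ∀ᶠ x in 𝓝[frontier Ω] x₀, g x < u x :=
    (hg x₀ hx₀).eventually_lt (hu.mono frontier_subset_closure x₀ hx₀) hcon
  rw [eventually_nhdsWithin_iff, Metric.eventually_nhds_iff] at hev
  obtain ⟨r, hr, hev⟩ := hev
  obtain ⟨M, hM⟩ := hΩc.exists_bound_of_continuousOn hu
  have hx₀c := frontier_subset_closure hx₀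
  obtain ⟨z, hz, hzΩ⟩ := hext (r / 8) (by positivity)
  obtain ⟨d, hd, hzd⟩ := Metric.isOpen_iff.1 isClosed_closure.isOpen_compl z hzΩ
  have hdist : ∀ x ∈ closure Ω, d ≤ ‖x - z‖ := fun x hx => by
    by_contra! hlt
    exact hzd (show dist x z < d by rwa [dist_eq_norm]) hx
  have hM0 : 0 ≤ M := (norm_nonneg _).trans (hM x₀ hx₀c)
  -- The first summand keeps the maximizer inside the ball. The second makes the gradient `2B(y -
  -- z)` longer than `L`, since every point of the closure is at distance at least `d` from `z`.
  set B := (2 * M + 1) / (r ^ 2 / 8) + |L| / d with hB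
  have hBr : 2 * M + 1 ≤ B * (r ^ 2 / 8) := by
    have h1 : (2 * M + 1) / (r ^ 2 / 8) * (r ^ 2 / 8) = 2 * M + 1 := by field_simp
    have h2 : 0 ≤ |L| / d * (r ^ 2 / 8) := by positivity
    rw [hB, add_mul]; linarith
  have hBpos : 0 < B := by positivity
  have hBd : L < 2 * B * d := by
    have h1 : |L| / d * d = |L| := by field_simp
    have h2 : 0 < (2 * M + 1) / (r ^ 2 / 8) * d := by positivity
    have h3 : B * d = (2 * M + 1) / (r ^ 2 / 8) * d + |L| := by rw [hB, add_mul, h1]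
    linarith [le_abs_self L, abs_nonneg L]
  have hxm : x₀ ∈ closure Ω ∩ Metric.closedBall x₀ (r / 2) :=
    ⟨hx₀c, Metric.mem_closedBall_self (by positivity)⟩
  obtain ⟨y, hy, hymax⟩ := (hΩc.inter_right (Metric.isClosed_closedBall (x := x₀) (ε := r / 2))).exists_isMaxOn
    ⟨x₀, hxm⟩ ((hu.mono inter_subset_left).sub
      (contDiff_const_mul_norm_sub_sq B z).continuous.continuousOn)
  have h1 := hymax hxm
  simp only [mem_ofPred_eq, Pi.sub_apply] at h1
  have h2 := abs_le.1 (hM x₀ hx₀c)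
  have h3 := abs_le.1 (hM y hy.1)
  have hyr : dist y x₀ < r / 2 := by
    refine lt_of_le_of_ne hy.2 fun he => ?_
    rw [← dist_eq_norm, ← dist_eq_norm, dist_comm x₀ z] at h1
    -- On the sphere the squared distance to `z` exceeds that of `x₀` by at least `(9 - 1) r²/64 =
    -- r²/8`.
    have h4 : 3 / 8 * r ≤ dist y z := by linarith [dist_triangle y z x₀]
    have h5 : (3 / 8 * r) ^ 2 ≤ dist y z ^ 2 := by gcongr
    have h6 : dist z x₀ ^ 2 ≤ (r / 8) ^ 2 := by gcongr
    have h7 : B * (r ^ 2 / 8) ≤ B * (dist y z ^ 2 - dist z x₀ ^ 2) := by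
      refine mul_le_mul_of_nonneg_left ?_ hBpos.le
      linarith
    linarith
  have hjet : (y, (2 * B) • (y - z)) ∈ superJet (closure Ω) u :=
    mem_superJet_iff.2 ⟨hy.1, _, contDiff_const_mul_norm_sub_sq B z,
      ⟨r / 2 - dist y x₀, by linarith, fun x hx hxd => hymax ⟨hx, show dist x x₀ ≤ r / 2 by
        linarith [dist_triangle x y x₀]⟩⟩, gradient_const_mul_norm_sub_sq B z y⟩
  rcases h y _ hjet with h4 | ⟨h4, h5⟩
  · rw [norm_smul, Real.norm_of_nonneg (by positivity)] at h4
    have := mul_le_mul_of_nonneg_left (hdist y hy.1) (by positivity : 0 ≤ 2 * B)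
    linarith
  · exact absurd h5 (not_le.2 (hev (by linarith) h4))

/-- The jet form of a solution of the weakly coupled Dirichlet problem. -/
structure IsJetSolution (Ω : Set (Eucl n)) (H : Bool → Eucl n → Eucl n → ℝ)
    (g : Bool → Eucl n → ℝ) (ε : ℝ) (u : Bool → Eucl n → ℝ) : Prop where
  cont : ∀ i, ContinuousOn (u i) (closure Ω)
  sub : ∀ i x p, (x, p) ∈ superJet (closure Ω) (u i) →
    u i x + H i (ε⁻¹ • x) p + ε⁻¹ * (u i x - u (!i) x) ≤ 0 ∨ (x ∈ frontier Ω ∧ u i x ≤ g i x)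
  super : ∀ i x p, (x, p) ∈ subJet (closure Ω) (u i) →
    0 ≤ u i x + H i (ε⁻¹ • x) p + ε⁻¹ * (u i x - u (!i) x) ∨ (x ∈ frontier Ω ∧ g i x ≤ u i x)

theorem IsDirichletSystemSolution.isJetSolution (hΩ : IsOpen Ω) {H : Bool → Eucl n → Eucl n → ℝ}
    {g u : Bool → Eucl n → ℝ} {ε : ℝ}
    (h : IsDirichletSystemSolution Ω (H true) (H false) (g true) (g false) ε (u true) (u false)) :
    IsJetSolution Ω H g ε u := by
  obtain ⟨h1, h2⟩ := h
  rw [isDirichletViscositySolution_iff hΩ] at h1 h2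
  exact ⟨fun i => by cases i; exacts [h2.1, h1.1], fun i => by cases i; exacts [h2.2.1, h1.2.1],
    fun i => by cases i; exacts [h2.2.2, h1.2.2]⟩

/-- The upper bound on `u i + ε⁻¹ (u i - u (!i))` follows from `H ≥ -m` at a dense set of interior
points. The lower bound is read off at the joint minimum of the components, from the equation with
zero gradient or from the boundary data. Together they control the coupling, hence the Hamiltonian
and the gradient. -/
theorem exists_uniform_bound (hΩ : IsOpen Ω) (hΩc : IsCompact (closure Ω))
    {H : Bool → Eucl n → Eucl n → ℝ} (hH : ∀ i, IsPeriodicCoercive (H i)) {g : Bool → Eucl n → ℝ}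
    (hg : ∀ i, ContinuousOn (g i) (frontier Ω)) :
    ∃ C L : ℝ, 0 ≤ L ∧ ∀ ε > 0, ∀ u, IsJetSolution Ω H g ε u →
      (∀ i, ∀ x ∈ closure Ω, |u i x| ≤ C) ∧
      (∀ i, ∀ x ∈ closure Ω, |u i x - u (!i) x| ≤ ε * C) ∧
      (∀ i x p, (x, p) ∈ superJet (closure Ω) (u i) →
        ‖p‖ ≤ L ∨ (x ∈ frontier Ω ∧ u i x ≤ g i x)) := by
  obtain ⟨C₀, hC₀, hC⟩ := exists_common_bound (p := fun i M => ∀ x, |H i x 0| ≤ M)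
    (fun b M M' h h' x => (h' x).trans h)
    (fun i => ((hH i).exists_abs_le 0).imp fun M hM x => hM x 0 (by simp))
  obtain ⟨m, hm0, hm⟩ := exists_common_bound (p := fun i M => ∀ x p, -M ≤ H i x p)
    (fun b M M' h h' x p => by linarith [h' x p]) (fun i => (hH i).exists_forall_ge)
  have hfc : IsCompact (frontier Ω) := hΩc.of_isClosed_subset isClosed_frontier
    frontier_subset_closure
  obtain ⟨Cg, hCg, hgb⟩ := exists_common_bound (p := fun i M => ∀ x ∈ frontier Ω, |g i x| ≤ M)
    (fun b M M' h h' x hx => (h' x hx).trans h)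
    (fun i => hfc.exists_bound_of_continuousOn (hg i))
  set C₁ := C₀ + Cg with hC₁
  obtain ⟨L, hL0, hL⟩ := exists_common_bound
    (p := fun i M => ∀ x p, H i x p ≤ 2 * C₁ + m → ‖p‖ ≤ M)
    (fun b M M' h h' x p hp => (h' x p hp).trans h)
    (fun i => ((hH i).exists_norm_le (2 * C₁ + m)).imp fun M hM => hM.2)
  refine ⟨m + C₁, L, hL0, fun ε hε u hu => ?_⟩
  have hε' : 0 < ε⁻¹ := inv_pos.2 hε
  have hupper : ∀ i, ∀ x ∈ closure Ω, u i x + ε⁻¹ * (u i x - u (!i) x) ≤ m := by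
    intro i
    have hF : ContinuousOn (fun x => u i x + ε⁻¹ * (u i x - u (!i) x)) (closure Ω) :=
      (hu.cont i).add (continuousOn_const.mul ((hu.cont i).sub (hu.cont !i)))
    refine fun x hx => le_on_closure (g := fun _ => m) (fun x hx => ?_) hF continuousOn_const hx
    refine le_of_superJet (F := fun x => u i x + ε⁻¹ * (u i x - u (!i) x)) hΩ
      ((hu.cont i).mono subset_closure) (hF.mono subset_closure) (fun y p hy hp => ?_) hx
    have h1 := (hu.sub i y p (superJet_mono (subset_univ _) (subset_closure hy) hp)).resolve_right
      fun h => notMem_frontier_of_mem hΩ hy h.1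
    linarith [hm i (ε⁻¹ • y) p]
  have hlower : ∀ i, ∀ x ∈ closure Ω, -C₁ ≤ u i x := by
    intro i x hx
    have hmin : ∀ j, ∃ y ∈ closure Ω, ∀ z ∈ closure Ω, u j y ≤ u j z := fun j =>
      hΩc.exists_isMinOn ⟨x, hx⟩ (hu.cont j)
    choose y hy hyle using hmin
    obtain ⟨j, hj⟩ : ∃ j, ∀ k, ∀ z ∈ closure Ω, u j (y j) ≤ u k z := by
      rcases le_total (u true (y true)) (u false (y false)) with h | h
      · exact ⟨true, fun k z hz => by cases k; exacts [h.trans (hyle _ z hz), hyle _ z hz]⟩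
      · exact ⟨false, fun k z hz => by cases k; exacts [hyle _ z hz, h.trans (hyle _ z hz)]⟩
    have hjet : (y j, 0) ∈ subJet (closure Ω) (u j) :=
      mem_subJet_iff.2 ⟨hy j, fun _ => 0, contDiff_const,
        ⟨1, one_pos, fun z hz _ => by simpa using hj j z hz⟩, gradient_fun_const _ _⟩
    refine le_trans ?_ (hj i x hx)
    rcases hu.super j _ _ hjet with h | ⟨h1, h2⟩
    · have h3 := hj (!j) (y j) (hy j)
      have h4 : ε⁻¹ * (u j (y j) - u (!j) (y j)) ≤ 0 :=
        mul_nonpos_of_nonneg_of_nonpos hε'.le (by linarith)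
      linarith [(abs_le.1 (hC j (ε⁻¹ • y j))).2]
    · linarith [(abs_le.1 (hgb j _ h1)).1]
  have hdiff : ∀ i, ∀ x ∈ closure Ω, u i x - u (!i) x ≤ ε * (m + C₁) := by
    intro i x hx
    have h1 := hupper i x hx
    have h2 := hlower i x hx
    have h3 : ε⁻¹ * (u i x - u (!i) x) ≤ m + C₁ := by linarith
    rwa [inv_mul_le_iff₀ hε] at h3
  refine ⟨fun i x hx => ?_, fun i x hx => ?_, fun i x p hp => ?_⟩
  · rw [abs_le]
    refine ⟨by linarith [hlower i x hx], ?_⟩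
    rcases le_total (u (!i) x) (u i x) with h | h
    · have h1 := hupper i x hx
      have h2 : 0 ≤ ε⁻¹ * (u i x - u (!i) x) := mul_nonneg hε'.le (by linarith)
      linarith
    · have h1 := hupper (!i) x hx
      rw [Bool.not_not] at h1
      have h2 : 0 ≤ ε⁻¹ * (u (!i) x - u i x) := mul_nonneg hε'.le (by linarith)
      linarith
  · have h1 := hdiff (!i) x hx
    rw [Bool.not_not] at h1
    rw [abs_le]
    exact ⟨by linarith, hdiff i x hx⟩
  · refine (hu.sub i x p hp).imp_left fun h => hL i (ε⁻¹ • x) p ?_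
    have h1 := hdiff (!i) x hp.1
    rw [Bool.not_not] at h1
    have h2 : ε⁻¹ * (u (!i) x - u i x) ≤ m + C₁ := by rwa [inv_mul_le_iff₀ hε]
    linarith [hlower i x hp.1]

end Dirichlet

/-! ### Perturbed test functions and passage to the limit. -/

section Homogenization

variable {n : ℕ} {Ω : Set (Eucl n)} {H : Bool → Eucl n → Eucl n → ℝ} {g : Bool → Eucl n → ℝ}

theorem superJet_rescale {f : Eucl n → ℝ} {ε : ℝ} (hε : 0 < ε) {x p : Eucl n}
    (h : (x, p) ∈ superJet univ fun y => ε * f (ε⁻¹ • y)) : (ε⁻¹ • x, p) ∈ superJet univ f := by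
  rw [mem_superJet_iff] at h ⊢
  obtain ⟨-, φ, hφ, ⟨r, hr, h⟩, hg⟩ := h
  have e : ε • ε⁻¹ • x = x := smul_inv_smul₀ hε.ne' x
  refine ⟨mem_univ _, fun y => ε⁻¹ * φ (ε • y),
    contDiff_const.mul (hφ.comp (contDiff_id.const_smul ε)),
    ⟨r / ε, by positivity, fun y _ hd => ?_⟩, by rw [gradient_rescale hφ hε.ne', e, hg]⟩
  have hd' : dist (ε • y) x < r := by
    rw [← e, dist_smul₀, Real.norm_of_nonneg hε.le, ← lt_div_iff₀' hε]
    exact hd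
  have h1 := mul_le_mul_of_nonneg_left (h (ε • y) (mem_univ _) hd') (inv_pos.2 hε).le
  rw [inv_smul_smul₀ hε.ne', mul_sub, mul_sub, inv_mul_cancel_left₀ hε.ne',
    inv_mul_cancel_left₀ hε.ne'] at h1
  simpa only [e] using h1

theorem subJet_rescale {f : Eucl n → ℝ} {ε : ℝ} (hε : 0 < ε) {x p : Eucl n}
    (h : (x, p) ∈ subJet univ fun y => ε * f (ε⁻¹ • y)) : (ε⁻¹ • x, p) ∈ subJet univ f := by
  rw [mem_subJet_iff_neg] at h ⊢
  refine superJet_rescale (f := fun y => -f y) hε ?_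
  simpa only [mul_neg] using h

/-- Transfers a viscosity inequality from jets to the limiting jets produced by doubling of
variables. -/
theorem le_of_mem_closure {J : Set (Eucl n × Eucl n)} {F : Eucl n × Eucl n → ℝ}
    {z : Eucl n × Eucl n} {C : ℝ} (hz : z ∈ closure J) (hF : ContinuousWithinAt F J z)
    (h : ∀ᶠ w in 𝓝[J] z, F w ≤ C) : F z ≤ C := by
  have := mem_closure_iff_nhdsWithin_neBot.1 hz
  exact le_of_tendsto hF h

theorem ge_of_mem_closure {J : Set (Eucl n × Eucl n)} {F : Eucl n × Eucl n → ℝ}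
    {z : Eucl n × Eucl n} {C : ℝ} (hz : z ∈ closure J) (hF : ContinuousWithinAt F J z)
    (h : ∀ᶠ w in 𝓝[J] z, C ≤ F w) : C ≤ F z := by
  have := mem_closure_iff_nhdsWithin_neBot.1 hz
  exact ge_of_tendsto hF h

theorem IsJetSolution.continuousOn_operator {ε : ℝ} {u : Bool → Eucl n → ℝ}
    (hH : ∀ i, IsPeriodicCoercive (H i)) (hu : IsJetSolution Ω H g ε u) (i : Bool) :
    ContinuousOn (fun z : Eucl n × Eucl n =>
      u i z.1 + H i (ε⁻¹ • z.1) z.2 + ε⁻¹ * (u i z.1 - u (!i) z.1)) (closure Ω ×ˢ univ) := by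
  have h : ∀ j, ContinuousOn (fun z : Eucl n × Eucl n => u j z.1) (closure Ω ×ˢ univ) := fun j =>
    (hu.cont j).comp continuousOn_fst fun z hz => hz.1
  have hHc : Continuous fun z : Eucl n × Eucl n => H i (ε⁻¹ • z.1) z.2 :=
    (hH i).cont.comp ((continuous_fst.const_smul ε⁻¹).prodMk continuous_snd)
  exact ((h i).add hHc.continuousOn).add (continuousOn_const.mul ((h i).sub (h !i)))

theorem exists_forall_le_of_compact {K : Set (Eucl n)} (hK : IsCompact K) (hne : K.Nonempty)
    {f : Bool → Eucl n → ℝ} (hf : ∀ i, ContinuousOn (f i) K) :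
    ∃ i, ∃ x ∈ K, ∀ j, ∀ y ∈ K, f j y ≤ f i x := by
  have hmax : ∀ j, ∃ y ∈ K, ∀ z ∈ K, f j z ≤ f j y := fun j => hK.exists_isMaxOn hne (hf j)
  choose y hy hyle using hmax
  rcases le_total (f true (y true)) (f false (y false)) with h | h
  · exact ⟨false, y false, hy _, fun k z hz => by
      cases k; exacts [hyle _ z hz, (hyle _ z hz).trans h]⟩
  · exact ⟨true, y true, hy _, fun k z hz => by
      cases k; exacts [(hyle _ z hz).trans h, hyle _ z hz]⟩

theorem exists_common_modulus (hH : ∀ i, IsPeriodicCoercive (H i)) (R : ℝ) {θ : ℝ} (hθ : 0 < θ) :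
    ∃ δ > 0, ∀ i, ∀ ξ p q : Eucl n, ‖p‖ ≤ R → ‖p - q‖ < δ → |H i ξ p - H i ξ q| < θ := by
  choose δ hδ h using fun i => (hH i).exists_modulus R hθ
  refine ⟨min (δ true) (δ false), lt_min (hδ _) (hδ _), fun i ξ p q hp hpq => h i ξ p q hp ?_⟩
  cases i
  · exact hpq.trans_le (min_le_right _ _)
  · exact hpq.trans_le (min_le_left _ _)

/-- Perturbed test function argument for subsolutions. -/
theorem limit_sub (hΩ : IsOpen Ω) (hH : ∀ i, IsPeriodicCoercive (H i)) {Hbar : Eucl n → ℝ}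
    (hbar : IsEffectiveHamiltonian (H true) (H false) Hbar) {u : ℝ → Bool → Eucl n → ℝ}
    (hu : ∀ ε > 0, IsJetSolution Ω H g ε (u ε)) {L : ℝ}
    (hL : ∀ ε > 0, ∀ i x p, x ∈ Ω → (x, p) ∈ superJet (closure Ω) (u ε i) → ‖p‖ ≤ L)
    {w : Eucl n → ℝ} (hw : ContinuousOn w (closure Ω))
    (hlim : ∀ η > 0, ∃ ε > 0, ε < η ∧ ∀ i, ∀ x ∈ closure Ω, |u ε i x - w x| < η)
    {x₀ P : Eucl n} (hx₀ : x₀ ∈ Ω) (hP : (x₀, P) ∈ superJet (closure Ω) w) :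
    w x₀ + Hbar P ≤ 0 := by
  by_contra! hcon
  obtain ⟨v, hv, hpv, -, hsuper⟩ := isCellConstant_iff.1 ((hbar P _).2 rfl)
  obtain ⟨Mv, hMv0, hMv⟩ := exists_common_bound (p := fun i M => ∀ x, |v i x| ≤ M)
    (fun b M M' h h' x => (h' x).trans h) (fun i => IsZPeriodic.exists_abs_le (hv i) (hpv i))
  obtain ⟨-, φ, hφ, ⟨r₀, hr₀, hmax⟩, rfl⟩ := mem_superJet_iff.1 hP
  -- Three errors below `θ` will be made: in the Hamiltonian, between `u ε i` and `w`, and between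
  -- `w x` and `w x₀`.
  set θ := (w x₀ + Hbar (gradient φ x₀)) / 4 with hθ
  have hθ0 : 0 < θ := by positivity
  obtain ⟨δ, hδ, hmod⟩ := exists_common_modulus hH L hθ0
  have hψ : ContDiff ℝ 1 fun y => φ y + 1 * ‖y - x₀‖ ^ 2 :=
    hφ.add (contDiff_const_mul_norm_sub_sq 1 x₀)
  set ψ : Eucl n → ℝ := fun y => φ y + 1 * ‖y - x₀‖ ^ 2 with hψdef
  have hgψ : gradient ψ x₀ = gradient φ x₀ := by
    rw [hψdef, gradient_fun_add hφ (contDiff_const_mul_norm_sub_sq 1 x₀),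
      gradient_const_mul_norm_sub_sq, sub_self, smul_zero, add_zero]
  have hev : ∀ᶠ y in 𝓝 x₀, y ∈ Ω ∧ dist (w y) (w x₀) < θ ∧
      dist (gradient ψ y) (gradient φ x₀) < δ := by
    refine (hΩ.eventually_mem hx₀).and (Eventually.and ?_ ?_)
    · exact Metric.tendsto_nhds.1 (hw.continuousAt (mem_of_superset (hΩ.mem_nhds hx₀)
        subset_closure)) θ hθ0
    · rw [← hgψ]
      exact Metric.tendsto_nhds.1 (continuous_gradient hψ).continuousAt δ hδ
  obtain ⟨r₁, hr₁, hnear⟩ := Metric.eventually_nhds_iff.1 hev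
  set r := min (r₀ / 2) (r₁ / 2) with hr
  have hrpos : 0 < r := by positivity
  have hr0 : r ≤ r₀ / 2 := min_le_left _ _
  have hr1 : r ≤ r₁ / 2 := min_le_right _ _
  have hballΩ : Metric.closedBall x₀ r ⊆ Ω := fun y hy =>
    (hnear (lt_of_le_of_lt hy (by linarith))).1
  -- Comparing values at `x` and `x₀` costs at most `2η + 2εMv ≤ r²/2`, which the penalty `‖x -
  -- x₀‖²` cannot exceed; the maximizer is therefore interior to the ball.
  have hη : 0 < min θ (r ^ 2 / (4 * (1 + Mv))) := by positivity
  obtain ⟨ε, hε, hεη, hclose⟩ := hlim _ hη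
  set η := min θ (r ^ 2 / (4 * (1 + Mv))) with hηdef
  have hηθ : η ≤ θ := min_le_left _ _
  have hηr : η * (4 * (1 + Mv)) ≤ r ^ 2 := by
    rw [← le_div_iff₀ (by positivity)]; exact min_le_right _ _
  have hεM : ε * Mv ≤ η * Mv := by gcongr
  have hεv : ∀ j y, |ε * v j y| ≤ ε * Mv := fun j y => by
    rw [abs_mul, abs_of_pos hε]; gcongr; exact hMv j y
  have huc : ∀ j, ContinuousOn (u ε j) (Metric.closedBall x₀ r) := fun j =>
    ((hu ε hε).cont j).mono (hballΩ.trans subset_closure)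
  have hvc : ∀ j, Continuous fun y => ε * v j (ε⁻¹ • y) := fun j =>
    continuous_const.mul ((hv j).comp (continuous_id.const_smul ε⁻¹))
  obtain ⟨i, x, hx, himax⟩ := exists_forall_le_of_compact (isCompact_closedBall x₀ r)
    ⟨x₀, Metric.mem_closedBall_self hrpos.le⟩
    (f := fun j y => u ε j y - ε * v j (ε⁻¹ • y) - ψ y)
    (fun j => ((huc j).sub (hvc j).continuousOn).sub hψ.continuous.continuousOn)
  have hxΩ : x ∈ Ω := hballΩ hx
  have hxr : dist x x₀ < r := by
    have h1 := himax i x₀ (Metric.mem_closedBall_self hrpos.le)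
    have h2 := abs_lt.1 (hclose i x₀ (subset_closure hx₀))
    have h3 := abs_lt.1 (hclose i x (subset_closure hxΩ))
    have h4 := abs_le.1 (hεv i (ε⁻¹ • x₀))
    have h5 := abs_le.1 (hεv i (ε⁻¹ • x))
    have h6 := hmax x (subset_closure hxΩ) (lt_of_le_of_lt hx (by linarith))
    simp only [hψdef, sub_self, norm_zero] at h1
    refine lt_of_pow_lt_pow_left₀ 2 hrpos.le ?_
    rw [dist_eq_norm]
    nlinarith
  obtain ⟨p, hpL, hp1, hp2⟩ := exists_mem_closure_superJet_subJet (f := u ε i)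
    (g := fun y => ε * v i (ε⁻¹ • y)) (φ := ψ) (R := L) isClosed_univ (mem_univ x)
    (sub_pos.2 hxr) ((huc i).mono (Metric.closedBall_subset_closedBall' (by linarith)))
    (hvc i).continuousOn hψ
    (fun y hy => himax i y (Metric.closedBall_subset_closedBall' (by linarith) hy.2))
    (fun y q hq hd => by
      have hyΩ : y ∈ Ω := hballΩ (show dist y x₀ ≤ r by linarith [dist_triangle y x x₀])
      exact hL ε hε i y q hyΩ (superJet_mono (subset_univ _) (subset_closure hyΩ) hq))
  have i1 : u ε i x + H i (ε⁻¹ • x) p + ε⁻¹ * (u ε i x - u ε (!i) x) ≤ 0 := by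
    have hnh : ∀ᶠ z : Eucl n × Eucl n in 𝓝 (x, p), z.1 ∈ Ω :=
      continuousAt_fst.eventually (hΩ.eventually_mem hxΩ)
    refine le_of_mem_closure hp1 (((hu ε hε).continuousOn_operator hH i).continuousAt ?_).continuousWithinAt
      ?_
    · filter_upwards [hnh] with z hz using ⟨subset_closure hz, mem_univ _⟩
    · filter_upwards [nhdsWithin_le_nhds hnh, self_mem_nhdsWithin] with z hz hzJ
      exact ((hu ε hε).sub i z.1 z.2 (superJet_mono (subset_univ _) (subset_closure hz)
        hzJ)).resolve_right fun h => notMem_frontier_of_mem hΩ hz h.1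
  have i2 : Hbar (gradient φ x₀) ≤ H i (ε⁻¹ • x) (gradient φ x₀ + (p - gradient ψ x)) +
      v i (ε⁻¹ • x) - v (!i) (ε⁻¹ • x) := by
    have hc1 : ∀ j, Continuous fun z : Eucl n × Eucl n => v j (ε⁻¹ • z.1) := fun j =>
      (hv j).comp (continuous_fst.const_smul ε⁻¹)
    have hc2 : Continuous fun z : Eucl n × Eucl n => H i (ε⁻¹ • z.1) (gradient φ x₀ + z.2) :=
      (hH i).cont.comp ((continuous_fst.const_smul ε⁻¹).prodMk
        (continuous_const.add continuous_snd))
    refine ge_of_mem_closure hp2 ((hc2.add (hc1 i)).sub (hc1 !i)).continuousWithinAt ?_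
    filter_upwards [self_mem_nhdsWithin] with z hz
    have := hsuper i _ _ (subJet_rescale hε hz)
    simp only [Pi.add_apply, Pi.sub_apply]
    linarith
  have hnx := hnear (show dist x x₀ < r₁ by linarith)
  have i3 := hmod i (ε⁻¹ • x) p (gradient φ x₀ + (p - gradient ψ x)) hpL (by
    rw [show p - (gradient φ x₀ + (p - gradient ψ x)) = gradient ψ x - gradient φ x₀ by abel,
      ← dist_eq_norm]
    exact hnx.2.2)
  -- This is the joint maximum tested against the other component at the same point.
  have i4 : v i (ε⁻¹ • x) - v (!i) (ε⁻¹ • x) ≤ ε⁻¹ * (u ε i x - u ε (!i) x) := by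
    rw [← div_eq_inv_mul, le_div_iff₀ hε]
    have := himax (!i) x hx
    linarith
  have i5 := abs_lt.1 (hclose i x (subset_closure hxΩ))
  have i6 := hnx.2.1
  rw [Real.dist_eq, abs_lt] at i6
  rw [abs_lt] at i3
  linarith

/-- Perturbed test function argument for supersolutions, up to the boundary. -/
theorem limit_super (hΩ : IsOpen Ω) (hΩc : IsCompact (closure Ω))
    (hH : ∀ i, IsPeriodicCoercive (H i)) (hg : ∀ i, ContinuousOn (g i) (frontier Ω))
    {Hbar : Eucl n → ℝ}
    (hbar : IsEffectiveHamiltonian (H true) (H false) Hbar) {u : ℝ → Bool → Eucl n → ℝ}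
    (hu : ∀ ε > 0, IsJetSolution Ω H g ε (u ε))
    {w : Eucl n → ℝ} (hw : ContinuousOn w (closure Ω))
    (hlim : ∀ η > 0, ∃ ε > 0, ε < η ∧ ∀ i, ∀ x ∈ closure Ω, |u ε i x - w x| < η)
    {x₀ P : Eucl n} (hP : (x₀, P) ∈ subJet (closure Ω) w)
    (hbd : x₀ ∈ frontier Ω → ∀ i, w x₀ < g i x₀) :
    0 ≤ w x₀ + Hbar P := by
  by_contra! hcon
  obtain ⟨v, hv, hpv, hsub, -⟩ := isCellConstant_iff.1 ((hbar P _).2 rfl)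
  obtain ⟨Mv, hMv0, hMv⟩ := exists_common_bound (p := fun i M => ∀ x, |v i x| ≤ M)
    (fun b M M' h h' x => (h' x).trans h) (fun i => IsZPeriodic.exists_abs_le (hv i) (hpv i))
  obtain ⟨R, hR⟩ := exists_superJet_bound hH (Hbar P)
  replace hR := hR P _ v le_rfl hv hsub
  obtain ⟨hx₀, φ, hφ, ⟨r₀, hr₀, hmin⟩, rfl⟩ := mem_subJet_iff.1 hP
  set P := gradient φ x₀ with hPdef
  set θ := -(w x₀ + Hbar P) / 4 with hθ
  have hθ0 : 0 < θ := by rw [hθ]; linarith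
  obtain ⟨δ, hδ, hmod⟩ := exists_common_modulus hH (‖P‖ + (R + ‖P‖)) hθ0
  have hψ : ContDiff ℝ 1 fun y => -(φ y - 1 * ‖y - x₀‖ ^ 2) :=
    (hφ.sub (contDiff_const_mul_norm_sub_sq 1 x₀)).neg
  set ψ : Eucl n → ℝ := fun y => -(φ y - 1 * ‖y - x₀‖ ^ 2) with hψdef
  have hgψ : gradient ψ x₀ = -P := by
    rw [hψdef, gradient_fun_neg, gradient_fun_sub hφ (contDiff_const_mul_norm_sub_sq 1 x₀),
      gradient_const_mul_norm_sub_sq, sub_self, smul_zero, sub_zero]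
  -- A gap `κ` between `w` and the data persists near `x₀`; as `u ε i` is within `κ` of `w`, the
  -- boundary alternative is excluded there.
  obtain ⟨κ, hκ, hκev⟩ : ∃ κ > 0, ∀ᶠ y in 𝓝 x₀, y ∈ frontier Ω → ∀ i, w y + κ < g i y := by
    by_cases hf : x₀ ∈ frontier Ω
    · have h1 : ∀ i, ∃ κ > 0, ∀ᶠ y in 𝓝 x₀, y ∈ frontier Ω → w y + κ < g i y := fun i => by
        refine ⟨(g i x₀ - w x₀) / 2, by linarith [hbd hf i], ?_⟩
        rw [← eventually_nhdsWithin_iff]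
        exact ((hw.mono frontier_subset_closure x₀ hf).add continuousWithinAt_const).eventually_lt
          (hg i x₀ hf) (by simp only [Pi.add_apply]; linarith [hbd hf i])
      choose κ hκ hκev using h1
      refine ⟨min (κ true) (κ false), lt_min (hκ _) (hκ _), ?_⟩
      filter_upwards [hκev true, hκev false] with y h1 h2 hy i
      cases i
      · linarith [h2 hy, min_le_right (κ true) (κ false)]
      · linarith [h1 hy, min_le_left (κ true) (κ false)]
    · refine ⟨1, one_pos, ?_⟩
      filter_upwards [hΩ.eventually_mem (mem_of_mem_closure_of_notMem_frontier hΩ hx₀ hf)]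
        with y hy hyf
      exact absurd hyf (notMem_frontier_of_mem hΩ hy)
  have hev : ∀ᶠ y in 𝓝 x₀, (y ∈ closure Ω → dist (w y) (w x₀) < θ) ∧
      dist (gradient ψ y) (-P) < δ ∧ (y ∈ frontier Ω → ∀ i, w y + κ < g i y) := by
    refine Eventually.and ?_ (Eventually.and ?_ hκev)
    · rw [← eventually_nhdsWithin_iff]
      exact Metric.tendsto_nhds.1 (hw x₀ hx₀) θ hθ0
    · rw [← hgψ]
      exact Metric.tendsto_nhds.1 (continuous_gradient hψ).continuousAt δ hδ
  obtain ⟨r₁, hr₁, hnear⟩ := Metric.eventually_nhds_iff.1 hev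
  set r := min (r₀ / 2) (r₁ / 2) with hr
  have hrpos : 0 < r := by positivity
  have hr0 : r ≤ r₀ / 2 := min_le_left _ _
  have hr1 : r ≤ r₁ / 2 := min_le_right _ _
  obtain ⟨ε, hε, hεη, hclose⟩ := hlim (min (min θ κ) (r ^ 2 / (4 * (1 + Mv)))) (by positivity)
  set η := min (min θ κ) (r ^ 2 / (4 * (1 + Mv))) with hηdef
  have hηθ : η ≤ θ := (min_le_left _ _).trans (min_le_left _ _)
  have hηκ : η ≤ κ := (min_le_left _ _).trans (min_le_right _ _)
  have hηr : η * (4 * (1 + Mv)) ≤ r ^ 2 := by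
    rw [← le_div_iff₀ (by positivity)]; exact min_le_right _ _
  have hεM : ε * Mv ≤ η * Mv := by gcongr
  have hεv : ∀ j y, |ε * v j y| ≤ ε * Mv := fun j y => by
    rw [abs_mul, abs_of_pos hε]; gcongr; exact hMv j y
  have hvc : ∀ j, Continuous fun y => ε * v j (ε⁻¹ • y) := fun j =>
    continuous_const.mul ((hv j).comp (continuous_id.const_smul ε⁻¹))
  have hcpt : IsCompact (closure Ω ∩ Metric.closedBall x₀ r) :=
    hΩc.inter_right Metric.isClosed_closedBall
  have hx₀m : x₀ ∈ closure Ω ∩ Metric.closedBall x₀ r := ⟨hx₀, Metric.mem_closedBall_self hrpos.le⟩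
  obtain ⟨i, x, hx, himax⟩ := exists_forall_le_of_compact hcpt ⟨x₀, hx₀m⟩
    (f := fun j y => ε * v j (ε⁻¹ • y) - u ε j y - ψ y)
    (fun j => ((hvc j).continuousOn.sub (((hu ε hε).cont j).mono inter_subset_left)).sub
      hψ.continuous.continuousOn)
  have hxr : dist x x₀ < r := by
    have h1 := himax i x₀ hx₀m
    have h2 := abs_lt.1 (hclose i x₀ hx₀)
    have h3 := abs_lt.1 (hclose i x hx.1)
    have h4 := abs_le.1 (hεv i (ε⁻¹ • x₀))
    have h5 := abs_le.1 (hεv i (ε⁻¹ • x))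
    have h6 := hmin x hx.1 (lt_of_le_of_lt hx.2 (by linarith))
    simp only [hψdef, sub_self, norm_zero] at h1
    refine lt_of_pow_lt_pow_left₀ 2 hrpos.le ?_
    rw [dist_eq_norm]
    nlinarith
  -- Here the corrector is the function with bounded superdifferentials and is defined on all of
  -- space. Only `u ε i` is restricted to the closure, so the argument also works at boundary
  -- points.
  obtain ⟨p, hpL, hp1, hp2⟩ := exists_mem_closure_superJet_subJet
    (f := fun y => ε * v i (ε⁻¹ • y)) (g := u ε i) (φ := ψ) (R := R + ‖P‖) isClosed_closure hx.1
    (sub_pos.2 hxr) (hvc i).continuousOn (((hu ε hε).cont i).mono inter_subset_left) hψ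
    (fun y hy => himax i y ⟨hy.1, Metric.closedBall_subset_closedBall' (by linarith) hy.2⟩)
    (fun y q hq _ => hR i _ q (superJet_rescale hε hq))
  have i1 : 0 ≤ u ε i x + H i (ε⁻¹ • x) (p - gradient ψ x) + ε⁻¹ * (u ε i x - u ε (!i) x) := by
    refine ge_of_mem_closure hp2 ((((hu ε hε).continuousOn_operator hH i) _ ⟨hx.1, mem_univ _⟩).mono
      fun z hz => ⟨hz.1, mem_univ _⟩) ?_
    have hnh : ∀ᶠ z : Eucl n × Eucl n in 𝓝 (x, p - gradient ψ x), dist z.1 x₀ < r :=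
      (continuous_fst.dist continuous_const).continuousAt.eventually_lt continuousAt_const hxr
    filter_upwards [nhdsWithin_le_nhds hnh, self_mem_nhdsWithin] with z hz hzJ
    refine ((hu ε hε).super i z.1 z.2 hzJ).resolve_right fun h => ?_
    have h1 := (hnear (show dist z.1 x₀ < r₁ by linarith)).2.2 h.1 i
    have h2 := abs_lt.1 (hclose i z.1 hzJ.1)
    linarith [h.2]
  have i2 : H i (ε⁻¹ • x) (P + p) + v i (ε⁻¹ • x) - v (!i) (ε⁻¹ • x) ≤ Hbar P := by
    have hc1 : ∀ j, Continuous fun z : Eucl n × Eucl n => v j (ε⁻¹ • z.1) := fun j =>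
      (hv j).comp (continuous_fst.const_smul ε⁻¹)
    have hc2 : Continuous fun z : Eucl n × Eucl n => H i (ε⁻¹ • z.1) (P + z.2) :=
      (hH i).cont.comp ((continuous_fst.const_smul ε⁻¹).prodMk
        (continuous_const.add continuous_snd))
    refine le_of_mem_closure hp1 ((hc2.add (hc1 i)).sub (hc1 !i)).continuousWithinAt ?_
    filter_upwards [self_mem_nhdsWithin] with z hz
    have := hsub i _ _ (superJet_rescale hε hz)
    simp only [Pi.add_apply, Pi.sub_apply]
    linarith
  have hnx := hnear (show dist x x₀ < r₁ by linarith)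
  have i3 := hmod i (ε⁻¹ • x) (P + p) (p - gradient ψ x)
    ((norm_add_le P p).trans (by linarith)) (by
    rw [show P + p - (p - gradient ψ x) = gradient ψ x - -P by abel, ← dist_eq_norm]
    exact hnx.2.1)
  have i4 : ε⁻¹ * (u ε i x - u ε (!i) x) ≤ v i (ε⁻¹ • x) - v (!i) (ε⁻¹ • x) := by
    rw [inv_mul_le_iff₀ hε]
    have := himax (!i) x hx
    linarith
  have i5 := abs_lt.1 (hclose i x hx.1)
  have i6 := hnx.1 hx.1
  rw [Real.dist_eq, abs_lt] at i6
  rw [abs_lt] at i3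
  linarith

end Homogenization

/-! ### Comparison and compactness for the limit problem. -/

section Convergence

variable {n : ℕ} {Ω : Set (Eucl n)} {H : Bool → Eucl n → Eucl n → ℝ} {g : Bool → Eucl n → ℝ}

/-- At a joint maximum of the corrector the gradient is zero and the coupling is nonnegative, so `H
i x P ≤ Hbar P` for some `i` and `x`; coercivity is inherited. -/
theorem IsEffectiveHamiltonian.exists_norm_le (hH : ∀ i, IsPeriodicCoercive (H i))
    {Hbar : Eucl n → ℝ} (hbar : IsEffectiveHamiltonian (H true) (H false) Hbar) (C : ℝ) :
    ∃ R, ∀ P, Hbar P ≤ C → ‖P‖ ≤ R := by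
  obtain ⟨R, -, hR⟩ := exists_common_bound (p := fun i M => ∀ x p, H i x p ≤ C → ‖p‖ ≤ M)
    (fun b M M' h h' x p hp => (h' x p hp).trans h)
    (fun i => ((hH i).exists_norm_le C).imp fun M hM => hM.2)
  refine ⟨R, fun P hP => ?_⟩
  obtain ⟨v, hv, hpv, hsub, -⟩ := isCellConstant_iff.1 ((hbar P _).2 rfl)
  obtain ⟨i, x, hx⟩ := exists_forall_sub_le (w := fun _ _ => 0) hv (fun _ => continuous_const) hpv
    (fun _ _ _ => rfl)
  have h1 := hsub i x 0 (mem_superJet_of_forall_le fun y => by linarith [hx i y])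
  have h2 := hx (!i) x
  simp only [add_zero] at h1
  exact hR i x P (by linarith)

/-- Comparison for the limit problem. -/
theorem limit_comparison (hΩ : IsOpen Ω) (hΩc : IsCompact (closure Ω))
    (hΩlip : HasLipschitzBoundary Ω) {Hbar : Eucl n → ℝ} (hcont : Continuous Hbar)
    (hcoer : ∀ C, ∃ R, ∀ P, Hbar P ≤ C → ‖P‖ ≤ R) {u w b : Eucl n → ℝ}
    (hb : ContinuousOn b (frontier Ω)) (hu : ContinuousOn u (closure Ω))
    (hw : ContinuousOn w (closure Ω))
    (hsub : ∀ x p, x ∈ Ω → (x, p) ∈ superJet (closure Ω) u → u x + Hbar p ≤ 0)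
    (hle : ∀ x ∈ frontier Ω, u x ≤ b x)
    (hsuper : ∀ x p, (x, p) ∈ subJet (closure Ω) w →
      0 ≤ w x + Hbar p ∨ (x ∈ frontier Ω ∧ b x ≤ w x)) :
    ∀ x ∈ closure Ω, u x ≤ w x := by
  by_contra! hcon
  obtain ⟨x₁, hx₁, hlt⟩ := hcon
  obtain ⟨x₀, hx₀, hmax⟩ := hΩc.exists_isMaxOn ⟨x₁, hx₁⟩ (hu.sub hw)
  have hpos : w x₀ < u x₀ := by
    have := hmax hx₁
    simp only [mem_ofPred_eq, Pi.sub_apply] at this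
    linarith
  obtain ⟨M, hM⟩ := hΩc.exists_bound_of_continuousOn hu
  obtain ⟨R, hR⟩ := hcoer M
  obtain ⟨ν, r, hr, hin⟩ := hΩlip.exists_inward hΩ hx₀
  have hsubΩ : ∀ x p, (x, p) ∈ superJet Ω u → u x + Hbar p ≤ 0 := by
    rintro x p ⟨hx, φ, hφ, hmax, hg⟩
    exact hsub x p hx ⟨subset_closure hx, φ, hφ, (hmax.isLocalMax (hΩ.mem_nhds hx)).on _, hg⟩
  obtain ⟨p, hp1, hp2⟩ := exists_mem_closure_superJet_subJet_of_inward hΩ hΩc hu hw hx₀ hr hin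
    (fun y hy => hmax hy) (R := R) (fun x p hp => hR p (by
      have h1 := hsubΩ x p hp
      have h2 := (abs_le.1 (hM x (subset_closure hp.1))).1
      linarith))
  have hF : ∀ f : Eucl n → ℝ, ContinuousOn f (closure Ω) → ∀ J : Set (Eucl n × Eucl n),
      (∀ z ∈ J, z.1 ∈ closure Ω) →
      ContinuousWithinAt (fun z : Eucl n × Eucl n => f z.1 + Hbar z.2) J (x₀, p) := by
    intro f hf J hJ
    have h1 : ContinuousWithinAt (fun z : Eucl n × Eucl n => f z.1) J (x₀, p) :=
      ContinuousWithinAt.comp (t := closure Ω) (hf x₀ hx₀) continuous_fst.continuousWithinAt hJ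
    exact h1.add (hcont.comp continuous_snd).continuousWithinAt
  have i1 : u x₀ + Hbar p ≤ 0 := le_of_mem_closure hp1
    (hF u hu _ fun z hz => subset_closure hz.1)
    (by filter_upwards [self_mem_nhdsWithin] with z hz using hsubΩ z.1 z.2 hz)
  -- At a boundary maximum `w < u ≤ b`, so nearby the supersolution satisfies the equation rather
  -- than the boundary alternative.
  have hev : ∀ᶠ y in 𝓝 x₀, y ∈ frontier Ω → w y < b y := by
    by_cases hf : x₀ ∈ frontier Ω
    · rw [← eventually_nhdsWithin_iff]
      exact (hw.mono frontier_subset_closure x₀ hf).eventually_lt (hb x₀ hf)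
        (hpos.trans_le (hle x₀ hf))
    · filter_upwards [hΩ.eventually_mem (mem_of_mem_closure_of_notMem_frontier hΩ hx₀ hf)]
        with y hy hyf
      exact absurd hyf (notMem_frontier_of_mem hΩ hy)
  have i2 : 0 ≤ w x₀ + Hbar p := by
    refine ge_of_mem_closure hp2 (hF w hw _ fun z hz => hz.1) ?_
    have hnh : ∀ᶠ z : Eucl n × Eucl n in 𝓝 (x₀, p), z.1 ∈ frontier Ω → w z.1 < b z.1 :=
      (continuous_fst.tendsto (x₀, p)).eventually hev
    filter_upwards [nhdsWithin_le_nhds hnh, self_mem_nhdsWithin] with z hz hzJ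
    exact (hsuper z.1 z.2 hzJ).resolve_right fun h => absurd h.2 (not_le.2 (hz h.1))
  linarith

/-- Precompactness of the solutions of the Dirichlet problems as `ε → 0`. -/
theorem exists_cluster_limit (hΩ : IsOpen Ω) (hΩc : IsCompact (closure Ω))
    (hΩlip : HasLipschitzBoundary Ω) {C L : ℝ} (hL0 : 0 ≤ L) {u : ℝ → Bool → Eucl n → ℝ}
    (hc : ∀ ε > 0, ∀ i, ContinuousOn (u ε i) (closure Ω))
    (hC : ∀ ε > 0, ∀ i, ∀ x ∈ closure Ω, |u ε i x| ≤ C)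
    (hd : ∀ ε > 0, ∀ i, ∀ x ∈ closure Ω, |u ε i x - u ε (!i) x| ≤ ε * C)
    (hL : ∀ ε > 0, ∀ i x p, x ∈ Ω → (x, p) ∈ superJet (closure Ω) (u ε i) → ‖p‖ ≤ L)
    {S : ℝ → Prop} (hS : ∃ᶠ ε in 𝓝[>] (0 : ℝ), S ε) :
    ∃ w, ContinuousOn w (closure Ω) ∧
      ∀ η > 0, ∃ ε > 0, S ε ∧ ε < η ∧ ∀ i, ∀ x ∈ closure Ω, |u ε i x - w x| < η := by
  -- Restricting the ultrafilter to `S` yields a limit along any prescribed frequent set of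
  -- parameters, in particular one where convergence is assumed to fail.
  have hne : (𝓝[>] (0 : ℝ) ⊓ 𝓟 {ε | S ε}).NeBot := frequently_mem_iff_neBot.1 hS
  set 𝓤 : Ultrafilter ℝ := Ultrafilter.of (𝓝[>] (0 : ℝ) ⊓ 𝓟 {ε | S ε})
  have hU : (𝓤 : Filter ℝ) ≤ 𝓝[>] (0 : ℝ) ⊓ 𝓟 {ε | S ε} := Ultrafilter.of_le _
  have hpos : ∀ᶠ ε in (𝓤 : Filter ℝ), 0 < ε := (hU.trans inf_le_left) self_mem_nhdsWithin
  have hSU : ∀ᶠ ε in (𝓤 : Filter ℝ), S ε := (hU.trans inf_le_right) (mem_principal_self _)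
  have hsmall : ∀ η > 0, ∀ᶠ ε in (𝓤 : Filter ℝ), ε < η := fun η hη =>
    ((hU.trans inf_le_left).trans nhdsWithin_le_nhds) (eventually_lt_nhds hη)
  obtain ⟨w, hw⟩ := exists_tendstoLocallyUniformlyOn_ultrafilter 𝓤 (F := fun ε => u ε true)
    (K := closure Ω)
    (fun x hx => ⟨C, by filter_upwards [hpos] with ε hε using hC ε hε true x hx⟩)
    (fun x hx η hη => by
      obtain ⟨r, hr, A, hA, hlip⟩ := hΩlip.exists_local_lipschitz hΩ hx
      refine ⟨min r (η / (A * L + 1)), by positivity, ?_⟩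
      filter_upwards [hpos] with ε hε y hy hyd
      have hj : ∀ z p, (z, p) ∈ superJet Ω (u ε true) → ‖p‖ ≤ L := by
        rintro z p ⟨hz, φ, hφ, hmax, hg⟩
        exact hL ε hε true z p hz
          ⟨subset_closure hz, φ, hφ, (hmax.isLocalMax (hΩ.mem_nhds hz)).on _, hg⟩
      have hyr := hyd.trans_le (min_le_left _ _)
      have hyη := hyd.trans_le (min_le_right _ _)
      rw [lt_div_iff₀ (by positivity), dist_eq_norm] at hyη
      have h1 := hlip L hL0 _ (hc ε hε true) hj y hy x hx hyr (by simpa using hr)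
      have h2 := hlip L hL0 _ (hc ε hε true) hj x hx y hy (by simpa using hr) hyr
      rw [norm_sub_rev x y] at h2
      have h3 := norm_nonneg (y - x)
      rw [abs_le]
      constructor <;> nlinarith)
  have hwu : TendstoUniformlyOn (fun ε => u ε true) w 𝓤 (closure Ω) :=
    (tendstoLocallyUniformlyOn_iff_tendstoUniformlyOn_of_compact hΩc).1 hw
  refine ⟨w, hwu.continuousOn (Eventually.frequently (by
    filter_upwards [hpos] with ε hε using hc ε hε true)), fun η hη => ?_⟩
  obtain ⟨ε, ⟨h1, h2⟩, h3, h4, h5⟩ := ((hpos.and hSU).and ((hsmall η hη).and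
    ((hsmall (η / (2 * (|C| + 1))) (by positivity)).and
    (Metric.tendstoUniformlyOn_iff.1 hwu (η / 2) (by positivity))))).exists
  refine ⟨ε, h1, h2, h3, fun i x hx => ?_⟩
  have h6 := h5 x hx
  rw [Real.dist_eq, abs_lt] at h6
  have h7 := abs_le.1 (hd ε h1 true x hx)
  simp only [Bool.not_true] at h7
  have h8 : ε * C < η / 2 := by
    rw [lt_div_iff₀ (by positivity)] at h4
    have : ε * C ≤ ε * |C| := by gcongr; exact le_abs_self C
    linarith
  rw [abs_lt]
  cases i <;> constructor <;> linarith

end Convergence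

/-! ### Proof of the homogenization theorem. -/

theorem mainTheorem4 {n : ℕ} (H₁ H₂ : Eucl n → Eucl n → ℝ)
    (hH₁ : Continuous (Function.uncurry H₁)) (hH₂ : Continuous (Function.uncurry H₂))
    (hcoer₁ : IsCoerciveHamiltonian H₁) (hcoer₂ : IsCoerciveHamiltonian H₂)
    (hper₁ : IsZPeriodic H₁) (hper₂ : IsZPeriodic H₂)
    (Ω : Set (Eucl n)) (hΩopen : IsOpen Ω) (hΩconn : IsConnected Ω)
    (hΩbdd : Bornology.IsBounded Ω) (hΩlip : HasLipschitzBoundary Ω)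
    (g₁ g₂ : Eucl n → ℝ) (hg₁ : ContinuousOn g₁ (frontier Ω))
    (hg₂ : ContinuousOn g₂ (frontier Ω))
    (u₁ u₂ : ℝ → Eucl n → ℝ)
    (hu : ∀ ε : ℝ, 0 < ε → IsDirichletSystemSolution Ω H₁ H₂ g₁ g₂ ε (u₁ ε) (u₂ ε)) :
    ∃ Hbar : Eucl n → ℝ, IsEffectiveHamiltonian H₁ H₂ Hbar ∧
      ∃ u : Eucl n → ℝ,
        IsDirichletViscositySolution Ω (fun _ r p => r + Hbar p)
          (fun x => min (g₁ x) (g₂ x)) u ∧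
        TendstoLocallyUniformlyOn u₁ u (𝓝[>] (0 : ℝ)) Ω ∧
        TendstoLocallyUniformlyOn u₂ u (𝓝[>] (0 : ℝ)) Ω := by
  have hΩc : IsCompact (closure Ω) := hΩbdd.isCompact_closure
  set H : Bool → Eucl n → Eucl n → ℝ := fun i => cond i H₁ H₂
  set g : Bool → Eucl n → ℝ := fun i => cond i g₁ g₂
  set u : ℝ → Bool → Eucl n → ℝ := fun ε i => cond i (u₁ ε) (u₂ ε)
  have hH : ∀ i, IsPeriodicCoercive (H i) := fun i => by
    cases i
    exacts [⟨hH₂, hcoer₂, hper₂⟩, ⟨hH₁, hcoer₁, hper₁⟩]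
  have hg : ∀ i, ContinuousOn (g i) (frontier Ω) := fun i => by
    cases i
    exacts [hg₂, hg₁]
  have hsol : ∀ ε > 0, IsJetSolution Ω H g ε (u ε) := fun ε hε =>
    IsDirichletSystemSolution.isJetSolution hΩopen (hu ε hε)
  obtain ⟨Hbar, hbar⟩ := exists_isEffectiveHamiltonian hH
  obtain ⟨C, L, hL0, hbd⟩ := exists_uniform_bound hΩopen hΩc hH hg
  have hL : ∀ ε > 0, ∀ i x p, x ∈ Ω → (x, p) ∈ superJet (closure Ω) (u ε i) → ‖p‖ ≤ L :=
    fun ε hε i x p hx hp => ((hbd ε hε _ (hsol ε hε)).2.2 i x p hp).resolve_right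
      fun h => notMem_frontier_of_mem hΩopen hx h.1
  have hug : ∀ ε > 0, ∀ i, ∀ x ∈ frontier Ω, u ε i x ≤ g i x := fun ε hε i x hx =>
    le_of_superJet_bound_or hΩc ((hsol ε hε).cont i) (hg i) ((hbd ε hε _ (hsol ε hε)).2.2 i) hx
      fun η hη => hΩlip.exists_notMem_closure hΩopen hx hη
  have hcluster := fun (S : ℝ → Prop) (hS : ∃ᶠ ε in 𝓝[>] (0 : ℝ), S ε) =>
    exists_cluster_limit hΩopen hΩc hΩlip hL0 (fun ε hε => (hsol ε hε).cont)
      (fun ε hε => (hbd ε hε _ (hsol ε hε)).1) (fun ε hε => (hbd ε hε _ (hsol ε hε)).2.1) hL hS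
  -- Every cluster limit is a subsolution in `Ω` lying pointwise below the boundary data, and a
  -- supersolution in the viscosity sense up to the boundary: exactly the hypotheses of comparison
  -- in both roles.
  have hsub : ∀ w, ContinuousOn w (closure Ω) →
      (∀ η > 0, ∃ ε > 0, ε < η ∧ ∀ i, ∀ x ∈ closure Ω, |u ε i x - w x| < η) →
      (∀ x p, x ∈ Ω → (x, p) ∈ superJet (closure Ω) w → w x + Hbar p ≤ 0) ∧
      (∀ x ∈ frontier Ω, w x ≤ min (g₁ x) (g₂ x)) ∧
      (∀ x p, (x, p) ∈ subJet (closure Ω) w →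
        0 ≤ w x + Hbar p ∨ (x ∈ frontier Ω ∧ min (g₁ x) (g₂ x) ≤ w x)) := by
    intro w hw hlim
    refine ⟨fun x p hx hp => limit_sub hΩopen hH hbar hsol hL hw hlim hx hp, fun x hx => ?_,
      fun x p hp => ?_⟩
    · have : ∀ i, w x ≤ g i x := fun i => le_of_forall_pos_le_add fun η hη => by
        obtain ⟨ε, hε, -, h⟩ := hlim η hη
        linarith [hug ε hε i x hx, (abs_lt.1 (h i x (frontier_subset_closure hx))).1]
      exact le_min (this true) (this false)
    · by_cases h : x ∈ frontier Ω ∧ min (g₁ x) (g₂ x) ≤ w x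
      · exact Or.inr h
      · refine Or.inl (limit_super hΩopen hΩc hH hg hbar hsol hw hlim hp fun hx i => ?_)
        have h1 : w x < min (g₁ x) (g₂ x) := not_le.1 fun h2 => h ⟨hx, h2⟩
        cases i
        exacts [h1.trans_le (min_le_right _ _), h1.trans_le (min_le_left _ _)]
  have hgmin : ContinuousOn (fun x => min (g₁ x) (g₂ x)) (frontier Ω) :=
    fun x hx => (hg₁ x hx).min (hg₂ x hx)
  obtain ⟨w, hw, hwlim⟩ := hcluster (fun _ => True)
    (Eventually.frequently (Eventually.of_forall fun _ => trivial))
  obtain ⟨hw1, hw2, hw3⟩ := hsub w hw fun η hη => by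
    obtain ⟨ε, hε, -, h⟩ := hwlim η hη
    exact ⟨ε, hε, h⟩
  have hconv : ∀ i, TendstoUniformlyOn (fun ε => u ε i) w (𝓝[>] (0 : ℝ)) (closure Ω) := by
    intro i
    by_contra hcon
    rw [Metric.tendstoUniformlyOn_iff] at hcon
    push Not at hcon
    obtain ⟨η, hη, hfreq⟩ := hcon
    -- Along parameters where `u ε i` stays `η`-far from `w` somewhere, another cluster limit
    -- exists; comparison in both directions identifies it with `w`, a contradiction.
    obtain ⟨w', hw', hlim'⟩ := hcluster _ hfreq
    obtain ⟨hw1', hw2', hw3'⟩ := hsub w' hw' fun η hη => by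
      obtain ⟨ε, hε, -, h⟩ := hlim' η hη
      exact ⟨ε, hε, h⟩
    have hle := limit_comparison hΩopen hΩc hΩlip (hbar.continuous hH) (hbar.exists_norm_le hH)
      hgmin hw hw' hw1 hw2 hw3'
    have hle' := limit_comparison hΩopen hΩc hΩlip (hbar.continuous hH) (hbar.exists_norm_le hH)
      hgmin hw' hw hw1' hw2' hw3
    obtain ⟨ε, hε, ⟨x, hx, hfar⟩, -, hnear⟩ := hlim' η hη
    have := hnear i x hx
    rw [le_antisymm (hle' x hx) (hle x hx), abs_sub_comm, ← Real.dist_eq] at this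
    exact absurd this (not_lt.2 hfar)
  refine ⟨Hbar, hbar, w, (isDirichletViscositySolution_iff hΩopen).2 ⟨hw, fun x p hp => ?_, hw3⟩,
    ((hconv true).mono subset_closure).tendstoLocallyUniformlyOn,
    ((hconv false).mono subset_closure).tendstoLocallyUniformlyOn⟩
  -- The boundary subsolution condition holds through its second alternative, since `w` lies below
  -- the data pointwise.
  by_cases hx : x ∈ frontier Ω
  · exact Or.inr ⟨hx, hw2 x hx⟩
  · exact Or.inl (hw1 x p (mem_of_mem_closure_of_notMem_frontier hΩopen hp.1 hx) hp)
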